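/- **Model.** Let $N$ run through the even integers. For each $N$ let $p_1,p_2>0$, $\kappa\in[0,1]$ with $\max(p_1,p_2)+\kappa\le 1$, and $\gamma$ (all may depend on $N$). Let $X_1,\dots,X_N$ be i.i.d. $\mathcal N(0,I_2)$, and let vertices $1,\dots,N/2$ and $N/2+1,\dots,N$ form two communities. Conditionally on $(X_i)$, the symmetric adjacency matrix $A\in\{0,1\}^{N\times N}$ has independent Bernoulli entries (up to symmetry), with $\mathbb P(A_{ij}=1\mid X)=\kappa e^{-\gamma\|X_i-X_j\|^2}+r_{ij}$ for $i\ne j$, where $r_{ij}=p_1$ if $i,j$ are in the same community and $r_{ij}=p_2$ otherwise; the diagonal entries are Bernoulli with an arbitrary parameter $s_N\in[0,1]$ ($s_N=0$: no self-loops; $s_N=p_1$: the conditional mean of $A$ is the block matrix plus $\kappa P$). Put $\lambda_1=N\frac{p_1+p_2}{2}$, $\lambda_2=N\frac{p_1-p_2}{2}$, $v_2=\frac1{\sqrt N}(1,\dots,1,-1,\dots,-1)^\top$; let $\mu_1$ be the largest eigenvalue of $\kappa P$, where $P_{ij}=e^{-\gamma\|X_i-X_j\|^2}$ for $i\neq j$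 and $P_{ii}=0$; and let $w_2$ be any unit eigenvector of $A$ for its second largest eigenvalue (counted with multiplicity). For $x\in\mathbb R^N$ let $\operatorname{sign}(x)_i=1/\sqrt N$ if $x_i\ge0$ and $-1/\sqrt N$ otherwise. **Assumptions.** Fix $0<c$ and $C<1$. Assume * $\gamma\to\infty$ and $\frac1\gamma\frac{N}{\ln N}\to\infty$; * for all large $N$, $\lambda_2^{-1}\frac{\kappa N}{2\gamma}\le C$ and $\frac{\lambda_2}{\lambda_1}\in[c,C]$; moreover $\lambda_2\gg\sqrt{\lambda_1}$; * $\lambda_1\gg\ln N$ (the graph is not sparse; this follows from the other assumptions when $\kappa$ is bounded away from $0$, in particular when $\kappa>0$ is fixed); * $\lambda_1>\lambda_2+\frac{\kappa}{\gamma}$ for all large $N$. **Theorem.** There are $\delta>0$ and $K$, depending only on $c$ and $C$, such that, under these assumptions: 1. (Soft recovery.) If also $\lambda_2^{-1}\frac{\kappa N}{2\gamma}\ge c$ for all large $N$ (signal and noise are of the same order), then $|w_2^\top v_2|\ge\delta$ with probability tending to $1$. 2. If $\lambda_2/\mu_1\to\infty$ in probability (that is, for every $M$, $M\mu_1\le\lambda_2$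 with probability tending to $1$), then $|w_2^\top v_2|\to1$ in probability, and $|\operatorname{sign}(w_2)^\top v_2|\to1$ in probability (weak, asymptotically exact, recovery). 3. (Explicit asymptotic bounds.) Let $q=\lambda_1/\lambda_2$ and $x=\mu_1/\lambda_2$. For every $\varepsilon>0$, with probability tending to $1$: for every real root $g$ of $$\big[g(q-1)-(3q+1)\big]-2x\big[(3q+1)g^2-2(q-1)g+(3q+1)\big]=0$$ with $(g+1)x\le\frac12$, $$(w_2^\top v_2)^2\ \ge\ \Big(1-\frac{2x}{q-1}\Big)\frac{(1-(g+1)x)^3}{\Big(1+\frac{g+1}{2(q-1)}x+\sqrt{q(g+1)x}\Big)^2}-\varepsilon ;$$ and, with probability tending to $1$, $$|w_2^\top v_2|\ \ge\ 1-\frac{2q}{\sqrt{q-1}}\sqrt{x}-Kx-\varepsilon .$$ -/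

import Mathlib

open Filter Topology MeasureTheory ProbabilityTheory

namespace PerturbedSBM

noncomputable section

/-- Parameters of the model for one graph size: the probabilities `p1`, `p2` of an edge inside and
between communities, the strength `κ` and the inverse width `γ` of the geometric perturbation, and
the probability `loop` of a self-loop (`loop = 0`: graphs without loops;
`loop = p1`: the conditional mean of the adjacency matrix is exactly `P₀ + κ P`). -/
structure Params where
  p1 : ℝ
  p2 : ℝ
  κ : ℝ
  γ : ℝ
  loop : ℝ

/-- The parameters describe probabilities. -/
structure Params.Admissible (θ : Params) : Prop where
  p1_pos : 0 < θ.p1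
  p2_pos : 0 < θ.p2
  κ_nonneg : 0 ≤ θ.κ
  max_add_le_one : max θ.p1 θ.p2 + θ.κ ≤ 1
  loop_nonneg : 0 ≤ θ.loop
  loop_le_one : θ.loop ≤ 1

/-! The graph has `N = 2 * n` vertices, indexed by `Fin (2 * n)`. The first `n` vertices form one
community, the last `n` the other one. -/

/-- The block model probabilities: `p1` if both vertices are in the same community, else `p2`. -/
def blockProb (n : ℕ) (θ : Params) (i j : Fin (2 * n)) : ℝ :=
  if ((i : ℕ) < n ↔ (j : ℕ) < n) then θ.p1 else θ.p2

/-- The normalized community vector `v₂ = σ`. -/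
def communityVec (n : ℕ) (i : Fin (2 * n)) : ℝ :=
  if (i : ℕ) < n then 1 / √((2 * n : ℕ) : ℝ) else -(1 / √((2 * n : ℕ) : ℝ))

/-- `λ₁ = N (p₁ + p₂) / 2`. -/
def lam1 (n : ℕ) (θ : Params) : ℝ := ((2 * n : ℕ) : ℝ) * (θ.p1 + θ.p2) / 2

/-- `λ₂ = N (p₁ - p₂) / 2`, the signal. -/
def lam2 (n : ℕ) (θ : Params) : ℝ := ((2 * n : ℕ) : ℝ) * (θ.p1 - θ.p2) / 2

/-- The order `κ N / (2 γ)` of the noise. -/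
def noise (n : ℕ) (θ : Params) : ℝ := θ.κ * ((2 * n : ℕ) : ℝ) / (2 * θ.γ)

/-- The latent positions, points of the plane. -/
abbrev Latent (n : ℕ) : Type := Fin (2 * n) → EuclideanSpace ℝ (Fin 2)

/-- The sample space: the latent positions, and a table of numbers of `[0, 1]` that decide on the
presence of the edges. -/
abbrev Sample (n : ℕ) : Type := Latent n × (Fin (2 * n) → Fin (2 * n) → unitInterval)

/-- The latent positions are i.i.d. with law `N(0, I₂)`; the edge variables are i.i.d. uniform on
`[0, 1]` and independent of the positions. -/
def law (n : ℕ) : Measure (Sample n) :=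
  (Measure.pi fun _ => stdGaussian (EuclideanSpace ℝ (Fin 2))).prod
    (Measure.pi fun _ => Measure.pi fun _ => (volume : Measure unitInterval))

/-- The matrix `P` of the Gaussian kernel, with zero diagonal. -/
def geomMatrix (n : ℕ) (θ : Params) (x : Latent n) : Matrix (Fin (2 * n)) (Fin (2 * n)) ℝ :=
  Matrix.of fun i j => if i = j then 0 else Real.exp (-θ.γ * ‖x i - x j‖ ^ 2)

/-- The probability of an edge given the latent positions: `κ exp (-γ |Xᵢ - Xⱼ|²) + rᵢⱼ`
for `i ≠ j`. -/
def edgeProb (n : ℕ) (θ : Params) (x : Latent n) (i j : Fin (2 * n)) : ℝ :=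
  if i = j then θ.loop else θ.κ * geomMatrix n θ x i j + blockProb n θ i j

/-- The adjacency matrix: conditionally on the positions, its entries are, up to symmetry,
independent Bernoulli variables with parameters `edgeProb`. -/
def adjMatrix (n : ℕ) (θ : Params) (ω : Sample n) : Matrix (Fin (2 * n)) (Fin (2 * n)) ℝ :=
  Matrix.of fun i j =>
    if (ω.2 (min i j) (max i j) : ℝ) < edgeProb n θ ω.1 i j then 1 else 0

open Classical in
/-- The eigenvalue with index `k` (counted from `0`, with multiplicity, in decreasing order) of a
real symmetric matrix. -/
def sortedEigenvalue {N : ℕ} (M : Matrix (Fin N) (Fin N) ℝ) (k : ℕ) : ℝ :=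
  if h : M.IsHermitian ∧ k < N then
    h.1.eigenvalues₀ ⟨k, by rw [Fintype.card_fin]; exact h.2⟩ else 0

/-- `w` is a normalized eigenvector of `M` for its second largest eigenvalue. -/
def IsSecondEigenvector {N : ℕ} (M : Matrix (Fin N) (Fin N) ℝ) (w : Fin N → ℝ) : Prop :=
  w ⬝ᵥ w = 1 ∧ M.mulVec w = sortedEigenvalue M 1 • w

/-- `μ₁`, the largest eigenvalue of `P₁ = κ P`. -/
def mu1 (n : ℕ) (θ : Params) (ω : Sample n) : ℝ :=
  sortedEigenvalue (θ.κ • geomMatrix n θ ω.1) 0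

/-- The vector of normalized signs of `w`, with values in `{±1/√N}`. -/
def signVec {N : ℕ} (w : Fin N → ℝ) (i : Fin N) : ℝ :=
  if 0 ≤ w i then 1 / √(N : ℝ) else -(1 / √(N : ℝ))

/-- The events `E n` hold with probability tending to one. -/
def WithHighProbability (E : ∀ n, Set (Sample n)) : Prop :=
  Tendsto (fun n => law n (E n)ᶜ) atTop (𝓝 0)

/-- With probability tending to one, the second eigenvector of the adjacency matrix has a
correlation of at least `ε` with the community vector: for `0 < ε`, soft recovery. -/
def SoftRecovery (θ : ℕ → Params) (ε : ℝ) : Prop :=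
  WithHighProbability fun n => {ω | ∀ w, IsSecondEigenvector (adjMatrix n (θ n) ω) w →
    ε ≤ |w ⬝ᵥ communityVec n|}

/-- With probability tending to one, the signs of the second eigenvector of the adjacency matrix
have a correlation of at least `ε` with the community vector: for `0 < ε`, weak recovery. -/
def WeakRecovery (θ : ℕ → Params) (ε : ℝ) : Prop :=
  WithHighProbability fun n => {ω | ∀ w, IsSecondEigenvector (adjMatrix n (θ n) ω) w →
    ε ≤ |signVec w ⬝ᵥ communityVec n|}

/-- `γ → ∞` and `γ ≪ N / ln N`. -/
def LatentRegime (θ : ℕ → Params) : Prop :=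
  Tendsto (fun n => (θ n).γ) atTop atTop ∧
    Tendsto (fun n => 1 / (θ n).γ * (((2 * n : ℕ) : ℝ) / Real.log ((2 * n : ℕ) : ℝ))) atTop atTop

/-- The noise is at most `C` times the signal, `λ₂ / λ₁ ∈ [c, C]`, and `λ₂ ≫ √λ₁`. -/
def SignalDominates (c C : ℝ) (θ : ℕ → Params) : Prop :=
  (∀ᶠ n in atTop, (lam2 n (θ n))⁻¹ * noise n (θ n) ≤ C) ∧
    (∀ᶠ n in atTop, lam2 n (θ n) / lam1 n (θ n) ∈ Set.Icc c C) ∧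
    Tendsto (fun n => lam2 n (θ n) / √(lam1 n (θ n))) atTop atTop

/-- The noise is at least `c` times the signal. -/
def NoiseComparable (c : ℝ) (θ : ℕ → Params) : Prop :=
  ∀ᶠ n in atTop, c ≤ (lam2 n (θ n))⁻¹ * noise n (θ n)

/-- `λ₁ ≫ ln N`: the graph is not sparse. -/
def NotSparse (θ : ℕ → Params) : Prop :=
  Tendsto (fun n => lam1 n (θ n) / Real.log ((2 * n : ℕ) : ℝ)) atTop atTop

/-- `λ₂ / μ₁ → ∞` in probability. -/
def RatioToInfinity (θ : ℕ → Params) : Prop :=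
  ∀ K : ℝ, WithHighProbability fun n => {ω | K * mu1 n (θ n) ω ≤ lam2 n (θ n)}

/-- The equation for the parameter `g` of the lower bound on the correlation, for
`q = λ₁ / λ₂` and `x = μ₁ / λ₂`. -/
def IsBoundParameter (q x g : ℝ) : Prop :=
  (g * (q - 1) - (3 * q + 1))
    - 2 * x * ((3 * q + 1) * g ^ 2 - 2 * (q - 1) * g + (3 * q + 1)) = 0

/-- The lower bound on the squared correlation, for `q = λ₁ / λ₂` and `x = μ₁ / λ₂`. -/
def sqCorrelationBound (q x g : ℝ) : ℝ :=
  (1 - 2 * x / (q - 1)) *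
    ((1 - (g + 1) * x) ^ 3 / (1 + (g + 1) / (2 * (q - 1)) * x + √(q * (g + 1) * x)) ^ 2)

/-- The leading terms, as `x → 0`, of the lower bound on the correlation. -/
def correlationExpansion (q x : ℝ) : ℝ := 1 - 2 * (q / √(q - 1)) * √x

end

end PerturbedSBM

namespace PerturbedSBM

open Matrix

/-! Up to a diagonal correction of size at most one, the conditional mean of `A` is a rank-two
matrix with eigenpairs `(λ₁, 1/√N)` and `(λ₂, v₂)`, plus `κ P`. The key point is that `v₂` is almost
in the kernel of `κ P`. Given `Xᵢ`, the coordinate `(P v₂)ᵢ` is a sum of independent terms whose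
signs balance, so only its fluctuations survive, and `E ‖κ P v₂‖² ≤ κ N / (2 γ)`. This is at most `C
λ₂`, whereas the natural scale is `λ₂²`. Hence `v₂` is an approximate eigenvector of `A` for the
eigenvalue `λ₂`.

The eigenvalue is isolated. The constant vector shows that the top eigenvalue is at least about `λ₁
≥ λ₂ / C`. On the orthogonal complement of the constant vector and `v₂` the block part vanishes, and
`κ P` is at most its largest row sum, about `κ N / (2 γ) ≤ C λ₂`; by Courant–Fischer so are all
eigenvalues from the third on. A residual `o(λ₂)` against a gap of order `(1 - C) λ₂` forces `(w₂ ·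
v₂)² → 1` (`sq_dotProduct_secondEigenvector_ge`, `sq_correlation_ge_of_bounds`).

The random fluctuation `A - E[A | X]` must be `o(λ₁)` in operator norm. It is compared with an
independent copy of the table; exchanging entries of the two tables turns the difference into a
matrix with random signs, and a noncommutative Khintchine inequality for moments of order `log N`
gives `O(√(λ₁ log N))`, with a Chernoff bound for the degrees. This is `o(λ₁)` because `λ₁ ≫ log N`.

Thus the correlation tends to one throughout, so soft and weak recovery hold, and the explicit lower
bounds follow because they never exceed one. -/

/-! ### Spectral theory of real symmetric matrices with sorted eigenvalues -/

theorem exists_spectral_decomposition {N : ℕ} {M : Matrix (Fin N) (Fin N) ℝ} (hM : M.IsHermitian) :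
    ∃ V : Matrix (Fin N) (Fin N) ℝ, V * Vᵀ = 1 ∧ Vᵀ * V = 1 ∧
      M = V * diagonal (fun k : Fin N => sortedEigenvalue M k) * Vᵀ := by
  classical
  -- `IsHermitian.eigenvalues` is the sorted list composed with an unspecified enumeration of the
  -- index type; `e` undoes it, so that index `1` carries the second eigenvalue.
  let e : Fin N ≃ Fin N :=
    (finCongr (Fintype.card_fin N).symm).trans (Fintype.equivOfCardEq (Fintype.card_fin _))
  let U : Matrix (Fin N) (Fin N) ℝ := hM.eigenvectorUnitary
  have hU1 : U * Uᵀ = 1 := by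
    have := Unitary.coe_mul_star_self hM.eigenvectorUnitary
    simpa [U, star_eq_conjTranspose, conjTranspose_eq_transpose_of_trivial] using this
  have hU2 : Uᵀ * U = 1 := by
    have := Unitary.coe_star_mul_self hM.eigenvectorUnitary
    simpa [U, star_eq_conjTranspose, conjTranspose_eq_transpose_of_trivial] using this
  have hs : M = U * diagonal hM.eigenvalues * Uᵀ := by
    have := hM.spectral_theorem
    rw [Unitary.conjStarAlgAut_apply] at this
    simpa [U, star_eq_conjTranspose, conjTranspose_eq_transpose_of_trivial, Function.comp_def]
      using this
  have hev : ∀ k : Fin N, sortedEigenvalue M k = hM.eigenvalues (e k) := by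
    intro k
    rw [sortedEigenvalue, dif_pos ⟨hM, k.2⟩, IsHermitian.eigenvalues]
    congr 1
    simp [e]
    rfl
  refine ⟨U.submatrix id e, ?_, ?_, ?_⟩
  · rw [transpose_submatrix, submatrix_mul_equiv, hU1, submatrix_one _ Function.injective_id]
  · rw [transpose_submatrix, ← submatrix_mul _ _ _ _ _ Function.bijective_id, hU2,
      submatrix_one _ e.injective]
  · have hd : diagonal (fun k : Fin N => sortedEigenvalue M k)
        = (diagonal hM.eigenvalues).submatrix e e := by
      rw [submatrix_diagonal_equiv]
      congr 1
      ext k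
      exact hev k
    rw [hd, transpose_submatrix, submatrix_mul_equiv, submatrix_mul_equiv, ← hs, submatrix_id_id]

theorem sortedEigenvalue_antitone {N : ℕ} {M : Matrix (Fin N) (Fin N) ℝ} (hM : M.IsHermitian)
    {k l : ℕ} (hkl : k ≤ l) (hl : l < N) : sortedEigenvalue M l ≤ sortedEigenvalue M k := by
  rw [sortedEigenvalue, dif_pos ⟨hM, hl⟩, sortedEigenvalue, dif_pos ⟨hM, hkl.trans_lt hl⟩]
  exact hM.eigenvalues₀_antitone hkl

section Orthogonal

variable {ι : Type*} [Fintype ι] [DecidableEq ι]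

theorem dotProduct_transpose_mulVec {V : Matrix ι ι ℝ} (hV : V * Vᵀ = 1) (u w : ι → ℝ) :
    (Vᵀ *ᵥ u) ⬝ᵥ (Vᵀ *ᵥ w) = u ⬝ᵥ w := by
  rw [mulVec_transpose, ← dotProduct_mulVec, mulVec_mulVec, hV, one_mulVec]

theorem transpose_mulVec_decomposition {V : Matrix ι ι ℝ} (hV : Vᵀ * V = 1) {d : ι → ℝ}
    {M : Matrix ι ι ℝ} (hM : M = V * diagonal d * Vᵀ) (u : ι → ℝ) (k : ι) :
    (Vᵀ *ᵥ (M *ᵥ u)) k = d k * (Vᵀ *ᵥ u) k := by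
  rw [mulVec_mulVec, hM, ← Matrix.mul_assoc, ← Matrix.mul_assoc, hV, Matrix.one_mul,
    ← mulVec_mulVec, mulVec_diagonal]

theorem dotProduct_mulVec_decomposition {V : Matrix ι ι ℝ} (hV : V * Vᵀ = 1) (hV' : Vᵀ * V = 1)
    {d : ι → ℝ} {M : Matrix ι ι ℝ} (hM : M = V * diagonal d * Vᵀ) (u : ι → ℝ) :
    u ⬝ᵥ (M *ᵥ u) = ∑ k, d k * (Vᵀ *ᵥ u) k ^ 2 := by
  rw [← dotProduct_transpose_mulVec hV, dotProduct]
  refine Finset.sum_congr rfl fun k _ => ?_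
  rw [transpose_mulVec_decomposition hV' hM]
  ring

theorem dotProduct_self_decomposition {V : Matrix ι ι ℝ} (hV : V * Vᵀ = 1) (u : ι → ℝ) :
    u ⬝ᵥ u = ∑ k, (Vᵀ *ᵥ u) k ^ 2 := by
  rw [← dotProduct_transpose_mulVec hV, dotProduct]
  exact Finset.sum_congr rfl fun k _ => by ring

end Orthogonal

theorem dotProduct_mulVec_le_sortedEigenvalue {N : ℕ} {M : Matrix (Fin N) (Fin N) ℝ}
    (hM : M.IsHermitian) (u : Fin N → ℝ) :
    u ⬝ᵥ (M *ᵥ u) ≤ sortedEigenvalue M 0 * (u ⬝ᵥ u) := by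
  obtain ⟨V, hV, hV', hd⟩ := exists_spectral_decomposition hM
  rw [dotProduct_mulVec_decomposition hV hV' hd, dotProduct_self_decomposition hV, Finset.mul_sum]
  refine Finset.sum_le_sum fun k _ => ?_
  exact mul_le_mul_of_nonneg_right (sortedEigenvalue_antitone hM (Nat.zero_le _) k.2) (sq_nonneg _)

/-- Courant–Fischer: a bound on the quadratic form on the orthogonal complement of two vectors
bounds all eigenvalues but the first two. -/
theorem sortedEigenvalue_le_of_forall_orthogonal {N : ℕ} {M : Matrix (Fin N) (Fin N) ℝ}
    (hM : M.IsHermitian) {v₁ v₂ : Fin N → ℝ} {B : ℝ}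
    (hB : ∀ u : Fin N → ℝ, u ⬝ᵥ v₁ = 0 → u ⬝ᵥ v₂ = 0 → u ⬝ᵥ (M *ᵥ u) ≤ B * (u ⬝ᵥ u))
    {k : ℕ} (hk : 2 ≤ k) (hkN : k < N) : sortedEigenvalue M k ≤ B := by
  obtain ⟨V, hV, hV', hd⟩ := exists_spectral_decomposition hM
  -- The span of the eigenvectors of indices `0`, `1`, `k` has dimension three, so it contains a
  -- nonzero vector orthogonal to both `v₁` and `v₂`. There the quadratic form is at least the
  -- `k`-th eigenvalue times the squared norm.
  let idx : Fin 3 → Fin N := ![⟨0, by omega⟩, ⟨1, by omega⟩, ⟨k, hkN⟩]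
  have hidx : Function.Injective idx := by
    intro a b hab
    have : (idx a : ℕ) = idx b := congrArg _ hab
    fin_cases a <;> fin_cases b <;> simp [idx] at this ⊢ <;> omega
  let T : Matrix (Fin 2) (Fin 3) ℝ := Matrix.of fun r s => (Vᵀ *ᵥ (![v₁, v₂] r)) (idx s)
  obtain ⟨a, ha, ha0⟩ : ∃ a : Fin 3 → ℝ, a ≠ 0 ∧ T *ᵥ a = 0 := by
    by_contra! h
    have hinj : Function.Injective T.mulVecLin := by
      rw [← LinearMap.ker_eq_bot, LinearMap.ker_eq_bot']
      intro a h0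
      by_contra hne
      exact h a hne h0
    have := LinearMap.finrank_le_finrank_of_injective hinj
    simp at this
  let c : Fin N → ℝ := fun j => ∑ s, if idx s = j then a s else 0
  have hc : ∀ f : Fin N → ℝ, ∑ j, f j * c j = ∑ s, f (idx s) * a s := by
    intro f
    simp only [c, Finset.mul_sum, mul_ite, mul_zero]
    rw [Finset.sum_comm]
    simp
  have hci : ∀ s, c (idx s) = a s := by
    intro s
    simp only [c, hidx.eq_iff]
    simp
  let u := V *ᵥ c
  have hVu : Vᵀ *ᵥ u = c := by simp [u, hV']
  have horth : ∀ r : Fin 2, u ⬝ᵥ (![v₁, v₂] r) = 0 := by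
    intro r
    rw [← dotProduct_transpose_mulVec hV, hVu, dotProduct_comm, dotProduct, hc]
    exact congrFun ha0 r
  have h := hB u (horth 0) (horth 1)
  have e1 : ∑ j : Fin N, sortedEigenvalue M j * c j ^ 2
      = ∑ s, sortedEigenvalue M (idx s) * a s ^ 2 := by
    simp only [pow_two, ← mul_assoc]
    rw [hc fun j => sortedEigenvalue M j * c j]
    exact Finset.sum_congr rfl fun s _ => by rw [hci]
  have e2 : ∑ j, c j ^ 2 = ∑ s, a s ^ 2 := by
    simp only [pow_two]
    rw [hc]
    exact Finset.sum_congr rfl fun s _ => by rw [hci]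
  rw [dotProduct_mulVec_decomposition hV hV' hd, dotProduct_self_decomposition hV, hVu, e1, e2] at h
  have hpos : 0 < ∑ s, a s ^ 2 := by
    obtain ⟨s, hs⟩ := Function.ne_iff.mp ha
    exact Finset.sum_pos' (fun _ _ => sq_nonneg _) ⟨s, Finset.mem_univ _, by have : a s ≠ 0 := hs; positivity⟩
  have hlow : sortedEigenvalue M k * ∑ s, a s ^ 2 ≤ ∑ s, sortedEigenvalue M (idx s) * a s ^ 2 := by
    rw [Finset.mul_sum]
    refine Finset.sum_le_sum fun s _ => mul_le_mul_of_nonneg_right ?_ (sq_nonneg _)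
    refine sortedEigenvalue_antitone hM ?_ hkN
    fin_cases s <;> simp [idx]
    omega
  exact le_of_mul_le_mul_right (hlow.trans h) hpos

/-- If `v` is an approximate eigenvector for an approximate eigenvalue `ℓ` that separates the first
from the third eigenvalue, then it is close to the second eigenvector. -/
theorem sq_dotProduct_secondEigenvector_ge {N : ℕ} {M : Matrix (Fin N) (Fin N) ℝ}
    (hM : M.IsHermitian) (hN : 2 ≤ N) {v w : Fin N → ℝ} {ℓ b τ : ℝ} (hv : v ⬝ᵥ v = 1)
    (hτ : 0 ≤ τ) (hτb : τ < b)
    (hres : (M *ᵥ v - ℓ • v) ⬝ᵥ (M *ᵥ v - ℓ • v) ≤ τ ^ 2)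
    (htop : ℓ + b ≤ sortedEigenvalue M 0)
    (hlow : ∀ k, 2 ≤ k → k < N → sortedEigenvalue M k ≤ ℓ - b)
    (hw : IsSecondEigenvector M w) : 1 - (τ / b) ^ 2 ≤ (w ⬝ᵥ v) ^ 2 := by
  obtain ⟨V, hV, hV', hd⟩ := exists_spectral_decomposition hM
  have hb : 0 < b := hτ.trans_lt hτb
  let α : Fin N → ℝ := fun k => sortedEigenvalue M k
  let i : Fin N := ⟨1, by omega⟩
  set c := Vᵀ *ᵥ v with hcdef
  have hc1 : ∑ k, c k ^ 2 = 1 := by rw [← dotProduct_self_decomposition hV, hv]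
  have hresid : ∑ k, (α k - ℓ) ^ 2 * c k ^ 2 ≤ τ ^ 2 := by
    refine le_of_eq_of_le ?_ hres
    rw [dotProduct_self_decomposition hV]
    refine Finset.sum_congr rfl fun k _ => ?_
    rw [mulVec_sub, mulVec_smul, Pi.sub_apply, transpose_mulVec_decomposition hV' hd,
      Pi.smul_apply, smul_eq_mul, ← hcdef]
    ring
  have hfar : ∀ k, k ≠ i → b ^ 2 ≤ (α k - ℓ) ^ 2 := by
    intro k hk
    rcases Nat.lt_or_ge (k : ℕ) 2 with h | h
    · have h0 : (k : ℕ) = 0 := by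
        have : (k : ℕ) ≠ 1 := fun h' => hk (Fin.ext h')
        omega
      have : α k = sortedEigenvalue M 0 := by simp only [α, h0]
      rw [this]
      nlinarith
    · have := hlow k h k.2
      change α k ≤ _ at this
      nlinarith
  -- The residual is `∑ (αₖ - ℓ)² cₖ²`, and each factor with `k ≠ 1` is at least `b²`: little mass
  -- of `v` lies off index `1`.
  have hsum : ∑ k ∈ Finset.univ.erase i, c k ^ 2 ≤ (τ / b) ^ 2 := by
    rw [div_pow, le_div_iff₀ (by positivity), Finset.sum_mul]
    refine le_trans ?_ hresid
    refine le_trans (Finset.sum_le_sum (g := fun k => (α k - ℓ) ^ 2 * c k ^ 2) fun k hk => ?_)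
      (Finset.sum_le_sum_of_subset_of_nonneg (Finset.erase_subset _ _)
        fun k _ _ => by positivity)
    rw [mul_comm]
    exact mul_le_mul_of_nonneg_right (hfar k (Finset.ne_of_mem_erase hk)) (sq_nonneg _)
  have hci : 1 - (τ / b) ^ 2 ≤ c i ^ 2 := by
    rw [← hc1, ← Finset.add_sum_erase _ _ (Finset.mem_univ i)]
    linarith
  -- Otherwise all eigenvalues would be at distance at least `b` from `ℓ` and the residual would be
  -- at least `b² > τ²`. Consequently the second eigenvalue is simple, and `w` is determined up to
  -- sign.
  have hnear : (α i - ℓ) ^ 2 < b ^ 2 := by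
    by_contra! h
    have : b ^ 2 * ∑ k, c k ^ 2 ≤ τ ^ 2 := by
      rw [Finset.mul_sum]
      refine le_trans (Finset.sum_le_sum fun k _ => ?_) hresid
      refine mul_le_mul_of_nonneg_right ?_ (sq_nonneg _)
      by_cases hk : k = i
      · rw [hk]; exact h
      · exact hfar k hk
    rw [hc1] at this
    nlinarith
  have hwk : ∀ k, k ≠ i → (Vᵀ *ᵥ w) k = 0 := by
    intro k hk
    have h1 := transpose_mulVec_decomposition hV' hd w k
    rw [hw.2, mulVec_smul, Pi.smul_apply, smul_eq_mul] at h1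
    have h2 : (α i - α k) * (Vᵀ *ᵥ w) k = 0 := by
      rw [sub_mul, sub_eq_zero]
      exact h1
    rcases mul_eq_zero.mp h2 with h | h
    · have := hfar k hk
      rw [← sub_eq_zero.mp h] at this
      exact absurd this (not_le.mpr hnear)
    · exact h
  have hwi : (Vᵀ *ᵥ w) i ^ 2 = 1 := by
    rw [← hw.1, dotProduct_self_decomposition hV]
    rw [Finset.sum_eq_single i (fun k _ hk => by rw [hwk k hk]; ring) (by simp)]
  have hwv : w ⬝ᵥ v = (Vᵀ *ᵥ w) i * c i := by
    rw [← dotProduct_transpose_mulVec hV, dotProduct]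
    exact Finset.sum_eq_single i (fun k _ hk => by rw [hwk k hk]; ring) (by simp)
  rw [hwv, mul_pow, hwi, one_mul]
  exact hci

/-! ### The community vector and rounding to signs -/

theorem communityVec_sq {n : ℕ} (i : Fin (2 * n)) :
    communityVec n i ^ 2 = 1 / ((2 * n : ℕ) : ℝ) := by
  have h : (1 / √((2 * n : ℕ) : ℝ)) ^ 2 = 1 / ((2 * n : ℕ) : ℝ) := by
    rw [div_pow, Real.sq_sqrt (by positivity), one_pow]
  rw [communityVec]
  split_ifs
  · exact h
  · rw [neg_sq, h]

theorem communityVec_dotProduct_self {n : ℕ} (hn : 0 < n) :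
    communityVec n ⬝ᵥ communityVec n = 1 := by
  simp only [dotProduct, ← pow_two, communityVec_sq]
  simp
  field_simp

theorem sum_communityVec (n : ℕ) : ∑ i, communityVec n i = 0 := by
  have h : ∀ i : Fin (2 * n), communityVec n i.rev = -communityVec n i := by
    intro i
    have := i.2
    simp only [communityVec, Fin.val_rev]
    split_ifs <;> first | omega | simp
  have h2 : ∑ i, communityVec n i = ∑ i, communityVec n (Fin.rev i) :=
    (Equiv.sum_comp Fin.revPerm _).symm
  simp only [h, Finset.sum_neg_distrib] at h2
  linarith

/-- A vertex with the wrong sign has `|s wᵢ - vᵢ| ≥ |vᵢ|`, where `s` aligns `w` with `v`. It loses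
`2 vᵢ²` in the correlation, which `2 (s wᵢ - vᵢ)²` pays for; summing gives `1 - 2 ‖s w - v‖²`. -/
theorem abs_signVec_dotProduct_communityVec_ge {n : ℕ} (hn : 0 < n) {w : Fin (2 * n) → ℝ}
    (hw : w ⬝ᵥ w = 1) :
    4 * |w ⬝ᵥ communityVec n| - 3 ≤ |signVec w ⬝ᵥ communityVec n| := by
  obtain ⟨s, hs, hsw⟩ : ∃ s : ℝ, (s = 1 ∨ s = -1) ∧ s * (w ⬝ᵥ communityVec n)
      = |w ⬝ᵥ communityVec n| := by
    rcases abs_choice (w ⬝ᵥ communityVec n) with h | h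
    · exact ⟨1, Or.inl rfl, by rw [h, one_mul]⟩
    · exact ⟨-1, Or.inr rfl, by rw [h]; ring⟩
  have hs2 : s ^ 2 = 1 := by rcases hs with rfl | rfl <;> norm_num
  have hle : s * (signVec w ⬝ᵥ communityVec n) ≤ |signVec w ⬝ᵥ communityVec n| := by
    rcases hs with rfl | rfl
    · rw [one_mul]; exact le_abs_self _
    · rw [neg_one_mul]; exact neg_le_abs _
  refine le_trans ?_ hle
  set a : ℝ := 1 / √((2 * n : ℕ) : ℝ) with ha
  have ha0 : 0 < a := by positivity
  have hpt : ∀ i, communityVec n i ^ 2 - 2 * (s * w i - communityVec n i) ^ 2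
      ≤ s * (signVec w i * communityVec n i) := by
    intro i
    simp only [communityVec, signVec, ← ha]
    rcases hs with rfl | rfl <;> split_ifs <;>
      nlinarith [sq_nonneg (w i - a), sq_nonneg (w i + a), sq_nonneg (w i)]
  have hsum := Finset.sum_le_sum fun i (_ : i ∈ Finset.univ) => hpt i
  have hexp : ∑ i, (communityVec n i ^ 2 - 2 * (s * w i - communityVec n i) ^ 2)
      = 4 * (s * (w ⬝ᵥ communityVec n)) - 2 * s ^ 2 * (w ⬝ᵥ w)
        - (communityVec n ⬝ᵥ communityVec n) := by
    simp only [dotProduct, Finset.mul_sum, ← Finset.sum_sub_distrib]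
    exact Finset.sum_congr rfl fun i _ => by ring
  rw [hexp, hsw, hw, hs2, communityVec_dotProduct_self hn, ← Finset.mul_sum] at hsum
  change _ ≤ s * (signVec w ⬝ᵥ communityVec n) at hsum
  linarith

/-! ### Trace inequalities for powers of symmetric matrices -/

section TraceInequality

variable {ι : Type*} [Fintype ι] [DecidableEq ι]

theorem pow_decomposition {V : Matrix ι ι ℝ} (hV : V * Vᵀ = 1) (hV' : Vᵀ * V = 1)
    {d : ι → ℝ} {M : Matrix ι ι ℝ} (hM : M = V * diagonal d * Vᵀ) (q : ℕ) :
    M ^ q = V * diagonal (fun k => d k ^ q) * Vᵀ := by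
  induction q with
  | zero => simp [hV]
  | succ q ih =>
    rw [pow_succ, ih, hM]
    calc V * diagonal (fun k => d k ^ q) * Vᵀ * (V * diagonal d * Vᵀ)
        = V * diagonal (fun k => d k ^ q) * (Vᵀ * V) * diagonal d * Vᵀ := by
          simp only [Matrix.mul_assoc]
      _ = _ := by
          rw [hV', Matrix.mul_one, Matrix.mul_assoc V, diagonal_mul_diagonal]
          simp only [pow_succ]

/-- In eigenbases of the two matrices the trace is a combination of scalars with nonnegative
weights, so scalar inequalities transfer to traces. -/
theorem trace_mul_decomposition {V U H : Matrix ι ι ℝ} (hH : Hᵀ = H) (x y : ι → ℝ) :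
    (H * (V * diagonal x * Vᵀ) * H * (U * diagonal y * Uᵀ)).trace
      = ∑ a, ∑ b, (Vᵀ * H * U) a b ^ 2 * (x a * y b) := by
  have h : (H * (V * diagonal x * Vᵀ) * H * (U * diagonal y * Uᵀ)).trace
      = ((Vᵀ * H * U)ᵀ * diagonal x * (Vᵀ * H * U) * diagonal y).trace := by
    rw [show H * (V * diagonal x * Vᵀ) * H * (U * diagonal y * Uᵀ)
      = (H * V * diagonal x * Vᵀ * H * U * diagonal y) * Uᵀ by simp only [Matrix.mul_assoc],
      trace_mul_comm]
    simp only [transpose_mul, transpose_transpose, hH, Matrix.mul_assoc]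
  rw [h]
  generalize Vᵀ * H * U = G
  have hG : ∀ b, (Gᵀ * diagonal x * G) b b = ∑ a, G a b ^ 2 * x a := fun b => by
    rw [mul_apply]
    refine Finset.sum_congr rfl fun a _ => ?_
    rw [mul_diagonal, transpose_apply]
    ring
  rw [trace]
  simp only [diag_apply, mul_diagonal]
  simp only [hG, Finset.sum_mul, _root_.mul_assoc]
  exact Finset.sum_comm

/-- Pair the index `q` with `r = 2k - q` and use that `|x|^q - |y|^q` and `|x|^r - |y|^r` have the
same sign. -/
theorem sum_pow_mul_pow_le (x y : ℝ) (k : ℕ) :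
    ∑ q ∈ Finset.range (2 * k + 1), x ^ q * y ^ (2 * k - q)
      ≤ (2 * k + 1) / 2 * (x ^ (2 * k) + y ^ (2 * k)) := by
  have hpair : ∀ q ∈ Finset.range (2 * k + 1),
      x ^ q * y ^ (2 * k - q) + x ^ (2 * k - q) * y ^ q ≤ x ^ (2 * k) + y ^ (2 * k) := by
    intro q hq
    obtain ⟨r, hr⟩ : ∃ r, 2 * k = q + r := ⟨2 * k - q, by have := Finset.mem_range.mp hq; omega⟩
    have habs : ∀ z : ℝ, z ^ (2 * k) = |z| ^ q * |z| ^ r := fun z => by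
      rw [← pow_add, ← hr, pow_mul, pow_mul, sq_abs]
    rw [show 2 * k - q = r by omega, habs x, habs y]
    have h1 : x ^ q * y ^ r ≤ |x| ^ q * |y| ^ r := by
      rw [← abs_pow, ← abs_pow, ← abs_mul]; exact le_abs_self _
    have h2 : x ^ r * y ^ q ≤ |x| ^ r * |y| ^ q := by
      rw [← abs_pow, ← abs_pow, ← abs_mul]; exact le_abs_self _
    have h3 : 0 ≤ (|x| ^ q - |y| ^ q) * (|x| ^ r - |y| ^ r) := by
      rcases le_total |x| |y| with h | h
      · exact mul_nonneg_of_nonpos_of_nonpos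
          (sub_nonpos.mpr (pow_le_pow_left₀ (abs_nonneg _) h _))
          (sub_nonpos.mpr (pow_le_pow_left₀ (abs_nonneg _) h _))
      · exact mul_nonneg (sub_nonneg.mpr (pow_le_pow_left₀ (abs_nonneg _) h _))
          (sub_nonneg.mpr (pow_le_pow_left₀ (abs_nonneg _) h _))
    nlinarith
  have hrefl : ∑ q ∈ Finset.range (2 * k + 1), x ^ (2 * k - q) * y ^ q
      = ∑ q ∈ Finset.range (2 * k + 1), x ^ q * y ^ (2 * k - q) := by
    rw [← Finset.sum_range_reflect]
    refine Finset.sum_congr rfl fun q hq => ?_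
    have := Finset.mem_range.mp hq
    rw [show 2 * k + 1 - 1 - q = 2 * k - q by omega, show 2 * k - (2 * k - q) = q by omega]
  have hs := Finset.sum_le_sum hpair
  rw [Finset.sum_add_distrib, hrefl, Finset.sum_const, Finset.card_range, nsmul_eq_mul] at hs
  push_cast at hs
  linarith

/-- Telescoping without commutativity: the factors `X` are replaced by `Y` one at a time. -/
theorem pow_sub_pow_eq_sum {R : Type*} [Ring R] (X Y : R) (m : ℕ) :
    X ^ m - Y ^ m = ∑ q ∈ Finset.range m, X ^ q * (X - Y) * Y ^ (m - 1 - q) := by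
  induction m with
  | zero => simp
  | succ m ih =>
    rw [Finset.sum_range_succ]
    have : ∑ q ∈ Finset.range m, X ^ q * (X - Y) * Y ^ (m + 1 - 1 - q)
        = (∑ q ∈ Finset.range m, X ^ q * (X - Y) * Y ^ (m - 1 - q)) * Y := by
      rw [Finset.sum_mul]
      refine Finset.sum_congr rfl fun q hq => ?_
      have := Finset.mem_range.mp hq
      rw [show m + 1 - 1 - q = (m - 1 - q) + 1 by omega, pow_succ, mul_assoc _ _ Y]
    rw [this, ← ih]
    simp [pow_succ]
    noncomm_ring

theorem sum_trace_mul_pow_le {N : ℕ} {X Y H : Matrix (Fin N) (Fin N) ℝ} (hX : X.IsHermitian)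
    (hY : Y.IsHermitian) (hH : Hᵀ = H) (k : ℕ) :
    ∑ q ∈ Finset.range (2 * k + 1), (H * X ^ q * H * Y ^ (2 * k - q)).trace
      ≤ (2 * k + 1) / 2 * ((H * H * X ^ (2 * k)).trace + (H * H * Y ^ (2 * k)).trace) := by
  obtain ⟨V, hV, hV', hVd⟩ := exists_spectral_decomposition hX
  obtain ⟨U, hU, hU', hUd⟩ := exists_spectral_decomposition hY
  set x : Fin N → ℝ := fun j => sortedEigenvalue X j
  set y : Fin N → ℝ := fun j => sortedEigenvalue Y j
  have key : ∀ q r, (H * X ^ q * H * Y ^ r).trace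
      = ∑ a, ∑ b, (Vᵀ * H * U) a b ^ 2 * (x a ^ q * y b ^ r) := fun q r => by
    rw [pow_decomposition hV hV' hVd q, pow_decomposition hU hU' hUd r,
      trace_mul_decomposition hH]
  have e1 : (H * H * X ^ (2 * k)).trace = (H * X ^ (2 * k) * H * Y ^ 0).trace := by
    rw [pow_zero, Matrix.mul_one, Matrix.mul_assoc, trace_mul_comm]
  have e2 : (H * H * Y ^ (2 * k)).trace = (H * X ^ 0 * H * Y ^ (2 * k)).trace := by
    rw [pow_zero, Matrix.mul_one]
  simp only [e1, e2, key]
  rw [Finset.sum_comm, ← Finset.sum_add_distrib, Finset.mul_sum]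
  refine Finset.sum_le_sum fun a _ => ?_
  rw [Finset.sum_comm, ← Finset.sum_add_distrib, Finset.mul_sum]
  refine Finset.sum_le_sum fun b _ => ?_
  rw [← Finset.mul_sum, ← mul_add, mul_left_comm, pow_zero, pow_zero, mul_one, one_mul]
  exact mul_le_mul_of_nonneg_left (sum_pow_mul_pow_le _ _ _) (sq_nonneg _)

/-- For scalars, `|a| ≤ s + s (a / s)^(2k)`, and the trace dominates each term `a^(2k)`. Unlike a
bound by a `2k`-th root, this one is linear in the trace, so expectations can be taken directly. -/
theorem abs_dotProduct_mulVec_le_trace_pow {N : ℕ} {X : Matrix (Fin N) (Fin N) ℝ}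
    (hX : X.IsHermitian) {s : ℝ} (hs : 0 < s) {k : ℕ} (hk : 1 ≤ k) {u : Fin N → ℝ}
    (hu : u ⬝ᵥ u = 1) :
    |u ⬝ᵥ (X *ᵥ u)| ≤ s + s * ((X ^ (2 * k)).trace / s ^ (2 * k)) := by
  obtain ⟨V, hV, hV', hd⟩ := exists_spectral_decomposition hX
  set x : Fin N → ℝ := fun j => sortedEigenvalue X j
  have hscal : ∀ a : ℝ, |a| ≤ s + s * (a ^ (2 * k) / s ^ (2 * k)) := by
    intro a
    have hpow : a ^ (2 * k) / s ^ (2 * k) = (|a| / s) ^ (2 * k) := by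
      rw [div_pow, pow_mul |a|, sq_abs, ← pow_mul]
    rw [hpow]
    rcases le_or_gt |a| s with h | h
    · have : 0 ≤ s * (|a| / s) ^ (2 * k) := by positivity
      linarith
    · have h1 : 1 ≤ |a| / s := (one_le_div hs).mpr h.le
      have h2 : |a| / s ≤ (|a| / s) ^ (2 * k) := le_self_pow₀ h1 (by omega)
      have h3 : |a| = s * (|a| / s) := by field_simp
      have h4 := mul_le_mul_of_nonneg_left h2 hs.le
      linarith
  have htr : (X ^ (2 * k)).trace = ∑ j, x j ^ (2 * k) := by
    rw [pow_decomposition hV hV' hd, trace_mul_comm, ← Matrix.mul_assoc, hV', Matrix.one_mul,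
      trace_diagonal]
  have hc : ∑ j, (Vᵀ *ᵥ u) j ^ 2 = 1 := by rw [← dotProduct_self_decomposition hV, hu]
  rw [dotProduct_mulVec_decomposition hV hV' hd, htr]
  calc |∑ j, x j * (Vᵀ *ᵥ u) j ^ 2| ≤ ∑ j, |x j| * (Vᵀ *ᵥ u) j ^ 2 := by
        refine (Finset.abs_sum_le_sum_abs _ _).trans (le_of_eq ?_)
        refine Finset.sum_congr rfl fun j _ => ?_
        rw [abs_mul, abs_of_nonneg (sq_nonneg ((Vᵀ *ᵥ u) j))]
    _ ≤ ∑ j, (s + s * ((∑ i, x i ^ (2 * k)) / s ^ (2 * k))) * (Vᵀ *ᵥ u) j ^ 2 := by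
        refine Finset.sum_le_sum fun j _ => mul_le_mul_of_nonneg_right ?_ (sq_nonneg _)
        refine (hscal _).trans ?_
        gcongr
        exact Finset.single_le_sum (f := fun i => x i ^ (2 * k))
          (fun i _ => by rw [pow_mul]; positivity) (Finset.mem_univ j)
    _ = _ := by rw [← Finset.mul_sum, hc, mul_one]

theorem diag_pow_even_nonneg {X : Matrix ι ι ℝ} (hX : Xᵀ = X) (k : ℕ) (i : ι) :
    0 ≤ (X ^ (2 * k)) i i := by
  rw [two_mul, pow_add]
  nth_rw 2 [← hX]
  rw [← transpose_pow, mul_apply]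
  exact Finset.sum_nonneg fun j _ => by rw [transpose_apply]; exact mul_self_nonneg _

end TraceInequality

/-! ### Noncommutative Khintchine inequality -/

section Khintchine

/-- The sign `±1` encoded by a Boolean. -/
def boolSign (b : Bool) : ℝ := if b then 1 else -1

theorem boolSign_mul_self (b : Bool) : boolSign b * boolSign b = 1 := by
  cases b <;> simp [boolSign]

theorem boolSign_not (b : Bool) : boolSign (!b) = -boolSign b := by
  cases b <;> simp [boolSign]

variable {α : Type*} {N : ℕ}

/-- The signed sum `∑ ±Hₑ`. -/
def signedSum [Fintype α] (H : α → Matrix (Fin N) (Fin N) ℝ) (ε : α → Bool) : Matrix (Fin N) (Fin N) ℝ :=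
  ∑ e, boolSign (ε e) • H e

theorem signedSum_transpose [Fintype α] {H : α → Matrix (Fin N) (Fin N) ℝ} (hH : ∀ e, (H e)ᵀ = H e)
    (ε : α → Bool) : (signedSum H ε)ᵀ = signedSum H ε := by
  simp [signedSum, transpose_sum, hH]

/-- Changing the sign at `e`. -/
def flipSign [DecidableEq α] (e : α) (ε : α → Bool) : α → Bool := Function.update ε e (!ε e)

theorem flipSign_involutive [DecidableEq α] (e : α) : Function.Involutive (flipSign e) := by
  intro ε
  simp [flipSign]

theorem signedSum_sub_flipSign [Fintype α] [DecidableEq α] (H : α → Matrix (Fin N) (Fin N) ℝ) (e : α) (ε : α → Bool) :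
    signedSum H ε - signedSum H (flipSign e ε) = (2 * boolSign (ε e)) • H e := by
  rw [signedSum, signedSum, ← Finset.sum_sub_distrib, Finset.sum_eq_single e]
  · rw [flipSign, Function.update_self, boolSign_not, ← sub_smul]
    congr 1
    ring
  · intro f _ hf
    rw [flipSign, Function.update_of_ne hf, sub_self]
  · simp

/-- Discrete integration by parts. One factor of the power is expanded as `∑ εₑ Hₑ`; averaging over
the flip of `εₑ` replaces the remaining power by half its discrete derivative. That telescopes into
`2k + 1` terms with a second `Hₑ`, and `∑ Hₑ²`, being diagonal and at most `v`, supplies the factor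
`v`. -/
theorem sum_trace_signedSum_pow_step [Fintype α] [DecidableEq α] {H : α → Matrix (Fin N) (Fin N) ℝ}
    (hH : ∀ e, (H e)ᵀ = H e) {D : Fin N → ℝ} (hD : ∑ e, H e * H e = diagonal D) {v : ℝ}
    (hv : ∀ i, D i ≤ v) (k : ℕ) :
    ∑ ε : α → Bool, (signedSum H ε ^ (2 * (k + 1))).trace
      ≤ (2 * k + 1) * v * ∑ ε : α → Bool, (signedSum H ε ^ (2 * k)).trace := by
  have hS : ∀ ε, (signedSum H ε).IsHermitian := fun ε => by
    rw [IsHermitian, conjTranspose_eq_transpose_of_trivial, signedSum_transpose hH]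
  have hexp : ∀ ε : α → Bool, (signedSum H ε ^ (2 * (k + 1))).trace
      = ∑ e, boolSign (ε e) * (H e * signedSum H ε ^ (2 * k + 1)).trace := by
    intro ε
    rw [show 2 * (k + 1) = (2 * k + 1) + 1 by ring, pow_succ']
    conv_lhs => enter [1, 1]; rw [signedSum]
    rw [Finset.sum_mul, trace_sum]
    simp
  have hflip : ∀ e, ∑ ε : α → Bool, boolSign (ε e) * (H e * signedSum H ε ^ (2 * k + 1)).trace
      ≤ (2 * k + 1) * ∑ ε : α → Bool, (H e * H e * signedSum H ε ^ (2 * k)).trace := by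
    intro e
    have hinv : ∀ F : (α → Bool) → ℝ, ∑ ε, F (flipSign e ε) = ∑ ε, F ε := fun F =>
      Equiv.sum_comp (flipSign_involutive e).toPerm F
    -- Symmetrization in the single sign `εₑ`: the flip preserves the sum over `ε` and changes the
    -- prefactor's sign.
    have h1 : ∑ ε : α → Bool, boolSign (ε e) * (H e * signedSum H ε ^ (2 * k + 1)).trace
        = ∑ ε : α → Bool, 1 / 2 * (boolSign (ε e) * (H e * (signedSum H ε ^ (2 * k + 1)
            - signedSum H (flipSign e ε) ^ (2 * k + 1))).trace) := by
      have h2 := hinv fun ε => boolSign (ε e) * (H e * signedSum H ε ^ (2 * k + 1)).trace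
      have h3 : ∀ ε : α → Bool, boolSign (flipSign e ε e) = -boolSign (ε e) := fun ε => by
        rw [flipSign, Function.update_self, boolSign_not]
      simp only [h3, neg_mul, Finset.sum_neg_distrib] at h2
      simp only [trace_sub, mul_sub, Finset.sum_sub_distrib, ← Finset.mul_sum]
      linarith
    rw [h1]
    have h4 : ∀ ε : α → Bool, 1 / 2 * (boolSign (ε e) * (H e * (signedSum H ε ^ (2 * k + 1)
            - signedSum H (flipSign e ε) ^ (2 * k + 1))).trace)
        ≤ (2 * k + 1) / 2 * ((H e * H e * signedSum H ε ^ (2 * k)).trace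
          + (H e * H e * signedSum H (flipSign e ε) ^ (2 * k)).trace) := by
      intro ε
      refine le_of_eq_of_le ?_ (sum_trace_mul_pow_le (hS ε) (hS (flipSign e ε)) (hH e) k)
      rw [pow_sub_pow_eq_sum, Finset.mul_sum, trace_sum, Finset.mul_sum, Finset.mul_sum]
      refine Finset.sum_congr rfl fun q _ => ?_
      rw [signedSum_sub_flipSign, Nat.add_sub_cancel]
      simp only [mul_smul_comm, smul_mul_assoc, trace_smul, smul_eq_mul, ← Matrix.mul_assoc]
      have := boolSign_mul_self (ε e)
      linear_combination (H e * signedSum H ε ^ q * H e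
        * signedSum H (flipSign e ε) ^ (2 * k - q)).trace * this
    refine (Finset.sum_le_sum fun ε _ => h4 ε).trans (le_of_eq ?_)
    rw [← Finset.mul_sum, Finset.sum_add_distrib,
      hinv fun ε => (H e * H e * signedSum H ε ^ (2 * k)).trace]
    ring
  simp only [hexp]
  rw [Finset.sum_comm]
  refine (Finset.sum_le_sum fun e _ => hflip e).trans ?_
  rw [← Finset.mul_sum, mul_assoc]
  refine mul_le_mul_of_nonneg_left ?_ (by positivity)
  rw [Finset.sum_comm, Finset.mul_sum]
  refine Finset.sum_le_sum fun ε _ => ?_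
  rw [← trace_sum, ← Finset.sum_mul, hD, trace, trace, Finset.mul_sum]
  refine Finset.sum_le_sum fun i _ => ?_
  rw [diag_apply, diag_apply, diagonal_mul]
  exact mul_le_mul_of_nonneg_right (hv i) (diag_pow_even_nonneg (signedSum_transpose hH ε) k i)

/-- The noncommutative Khintchine inequality for the even moments of a signed sum. -/
theorem sum_trace_signedSum_pow_le [Fintype α] [DecidableEq α] {H : α → Matrix (Fin N) (Fin N) ℝ}
    (hH : ∀ e, (H e)ᵀ = H e) {D : Fin N → ℝ} (hD : ∑ e, H e * H e = diagonal D) {v : ℝ}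
    (hv0 : 0 ≤ v) (hv : ∀ i, D i ≤ v) (k : ℕ) :
    ∑ ε : α → Bool, (signedSum H ε ^ (2 * k)).trace
      ≤ Fintype.card (α → Bool) * (N * (2 * k * v) ^ k) := by
  have h : ∀ j, j ≤ k → ∑ ε : α → Bool, (signedSum H ε ^ (2 * j)).trace
      ≤ Fintype.card (α → Bool) * (N * (2 * k * v) ^ j) := by
    intro j
    induction j with
    | zero => intro _; simp
    | succ j ih =>
      intro hj
      refine (sum_trace_signedSum_pow_step hH hD hv j).trans ?_
      have hjk : (j : ℝ) + 1 ≤ k := by exact_mod_cast hj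
      calc (2 * j + 1) * v * ∑ ε : α → Bool, (signedSum H ε ^ (2 * j)).trace
          ≤ (2 * k * v) * (Fintype.card (α → Bool) * (N * (2 * k * v) ^ j)) := by
            refine mul_le_mul ?_ (ih (by omega)) ?_ (by positivity)
            · exact mul_le_mul_of_nonneg_right (by linarith) hv0
            · exact Finset.sum_nonneg fun ε _ => Finset.sum_nonneg fun i _ =>
                diag_pow_even_nonneg (signedSum_transpose hH ε) j i
        _ = _ := by ring
  exact h k le_rfl

/-- The part of a symmetric matrix supported by the edge `e`. -/
def edgePart (m : Matrix (Fin N) (Fin N) ℝ) (e : Fin N × Fin N) : Matrix (Fin N) (Fin N) ℝ :=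
  Matrix.of fun i j => if (min i j, max i j) = e then m i j else 0

theorem edgePart_transpose {m : Matrix (Fin N) (Fin N) ℝ} (hm : mᵀ = m) (e : Fin N × Fin N) :
    (edgePart m e)ᵀ = edgePart m e := by
  ext i j
  have : m j i = m i j := congrFun (congrFun hm i) j
  simp only [edgePart, transpose_apply, of_apply, min_comm j i, max_comm j i, this]

theorem signedSum_edgePart (m : Matrix (Fin N) (Fin N) ℝ) (ε : Fin N × Fin N → Bool) :
    signedSum (edgePart m) ε
      = Matrix.of fun i j => boolSign (ε (min i j, max i j)) * m i j := by
  ext i j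
  simp [signedSum, edgePart, Matrix.sum_apply]

/-- Two consecutive entries `(i, j)`, `(j, l)` belong to the same undirected edge only if `i = l`.
So the variance parameter in Khintchine's inequality is the largest row sum of squares. -/
theorem sum_edgePart_mul_self {m : Matrix (Fin N) (Fin N) ℝ} (hm : mᵀ = m) :
    ∑ e, edgePart m e * edgePart m e = diagonal fun i => ∑ j, m i j ^ 2 := by
  ext i l
  simp only [Matrix.sum_apply, mul_apply, edgePart, of_apply]
  rw [Finset.sum_comm]
  by_cases hil : i = l
  · subst hil
    rw [diagonal_apply_eq]
    refine Finset.sum_congr rfl fun j _ => ?_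
    have : m j i = m i j := congrFun (congrFun hm i) j
    simp [min_comm j i, max_comm j i, this, pow_two]
  · rw [diagonal_apply_ne _ hil]
    refine Finset.sum_eq_zero fun j _ => Finset.sum_eq_zero fun e _ => ?_
    by_cases h1 : (min i j, max i j) = e
    · have h2 : (min j l, max j l) ≠ e := by
        rintro rfl
        rw [Prod.mk.injEq] at h1
        rcases le_total i j with hij | hij <;> rcases le_total j l with hjl | hjl <;>
          simp only [min_eq_left, min_eq_right, max_eq_left, max_eq_right, hij, hjl] at h1 <;>
          simp_all
      rw [if_neg h2, mul_zero]
    · rw [if_neg h1, zero_mul]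

end Khintchine

/-! ### Exponential moments of sums of independent variables -/

section Chernoff

/-- Convexity puts `exp (t f)` below the chord `1 + (exp t - 1) f` on `[0, 1]`; then `1 + z ≤ exp
z`. -/
theorem integral_exp_mul_le {Ω : Type*} [MeasurableSpace Ω] {m : Measure Ω} [IsProbabilityMeasure m]
    {f : Ω → ℝ} (hf : Measurable f) (h0 : ∀ x, 0 ≤ f x) (h1 : ∀ x, f x ≤ 1) (t : ℝ) :
    ∫ x, Real.exp (t * f x) ∂m ≤ Real.exp ((Real.exp t - 1) * ∫ x, f x ∂m) := by
  have hfi : Integrable f m := Integrable.of_bound hf.aestronglyMeasurable 1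
    (ae_of_all _ fun x => by rw [Real.norm_eq_abs, abs_of_nonneg (h0 x)]; exact h1 x)
  have hpt : ∀ x, Real.exp (t * f x) ≤ 1 + (Real.exp t - 1) * f x := by
    intro x
    have := convexOn_exp.2 (Set.mem_univ t) (Set.mem_univ 0) (h0 x) (sub_nonneg.mpr (h1 x))
      (by ring)
    simp only [smul_eq_mul, mul_zero, add_zero, Real.exp_zero, mul_one] at this
    rw [mul_comm t]
    linarith
  calc ∫ x, Real.exp (t * f x) ∂m ≤ ∫ x, (1 + (Real.exp t - 1) * f x) ∂m := by
        refine integral_mono_of_nonneg (ae_of_all _ fun x => (Real.exp_pos _).le) ?_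
          (ae_of_all _ hpt)
        exact (integrable_const _).add (hfi.const_mul _)
    _ = (Real.exp t - 1) * ∫ x, f x ∂m + 1 := by
        rw [integral_add (integrable_const _) (hfi.const_mul _), integral_const_mul]
        simp [add_comm]
    _ ≤ _ := Real.add_one_le_exp _

theorem integral_exp_sum_le {ι : Type*} [Fintype ι] {Ω : ι → Type*} [∀ i, MeasurableSpace (Ω i)]
    {m : ∀ i, Measure (Ω i)} [∀ i, IsProbabilityMeasure (m i)] {f : ∀ i, Ω i → ℝ} {t : ℝ}
    {c : ι → ℝ} (hf : ∀ i, ∫ x, Real.exp (t * f i x) ∂(m i) ≤ Real.exp (c i)) :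
    ∫ x, Real.exp (t * ∑ i, f i (x i)) ∂(Measure.pi m) ≤ Real.exp (∑ i, c i) := by
  simp only [Finset.mul_sum, Real.exp_sum]
  rw [integral_fintype_prod_eq_prod (f := fun i x => Real.exp (t * f i x))]
  exact Finset.prod_le_prod (fun i _ => integral_nonneg fun x => (Real.exp_pos _).le)
    fun i _ => hf i

end Chernoff

/-! ### The random table of edges: exchange symmetry, means, degrees -/

section Table

noncomputable section

variable {N : ℕ}

/-- The law of the table of variables that decide on the edges. -/
def tableLaw (N : ℕ) : Measure (Fin N → Fin N → unitInterval) :=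
  Measure.pi fun _ => Measure.pi fun _ => (volume : Measure unitInterval)

instance : IsProbabilityMeasure (tableLaw N) := by
  unfold tableLaw
  infer_instance

/-- Exchanging the entries of two tables at the places where `ε` is false. -/
def swapTables (ε : Fin N × Fin N → Bool)
    (z : (Fin N → Fin N → unitInterval) × (Fin N → Fin N → unitInterval)) :
    (Fin N → Fin N → unitInterval) × (Fin N → Fin N → unitInterval) :=
  (fun a b => if ε (a, b) then z.1 a b else z.2 a b,
    fun a b => if ε (a, b) then z.2 a b else z.1 a b)

theorem measurePreserving_prod_pi {ι α : Type*} [Fintype ι] [MeasurableSpace α]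
    {μ : ι → Measure α} [∀ i, SigmaFinite (μ i)] {f : ι → α × α → α × α}
    (hf : ∀ i, MeasurePreserving (f i) ((μ i).prod (μ i)) ((μ i).prod (μ i))) :
    MeasurePreserving (fun z : (ι → α) × (ι → α) =>
      ((fun i => (f i (z.1 i, z.2 i)).1, fun i => (f i (z.1 i, z.2 i)).2) : (ι → α) × (ι → α)))
      ((Measure.pi μ).prod (Measure.pi μ)) ((Measure.pi μ).prod (Measure.pi μ)) := by
  have h := measurePreserving_arrowProdEquivProdArrow α α ι μ μ
  exact h.comp ((measurePreserving_pi _ _ hf).comp h.symm)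

/-- Coordinatewise, the map is the identity or the exchange of two independent variables of the same
law. -/
theorem measurePreserving_swapTables (ε : Fin N × Fin N → Bool) :
    MeasurePreserving (swapTables ε) ((tableLaw N).prod (tableLaw N))
      ((tableLaw N).prod (tableLaw N)) := by
  have h := measurePreserving_prod_pi (fun a : Fin N => measurePreserving_prod_pi
    (μ := fun _ : Fin N => (volume : Measure unitInterval))
    (f := fun b : Fin N => if ε (a, b) then id else Prod.swap) fun b => by
      split_ifs
      · exact MeasurePreserving.id _
      · exact Measure.measurePreserving_swap)
  convert h using 1
  · ext z a b <;> simp only [swapTables] <;> split_ifs <;> rfl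
  · rfl
  · rfl

/-- The edges that the table `U` selects for the edge probabilities `p`. -/
def edgePattern (p : Fin N → Fin N → ℝ) (U : Fin N → Fin N → unitInterval) : Fin N → Fin N → Bool :=
  fun a b => decide ((U a b : ℝ) < p a b)

/-- The symmetric matrix given by the upper triangle of a pattern. -/
def patternMatrix (b : Fin N → Fin N → Bool) : Matrix (Fin N) (Fin N) ℝ :=
  Matrix.of fun i j => if b (min i j) (max i j) then 1 else 0

theorem patternMatrix_transpose (b : Fin N → Fin N → Bool) :
    (patternMatrix b)ᵀ = patternMatrix b := by
  ext i j
  simp only [patternMatrix, transpose_apply, of_apply, min_comm j i, max_comm j i]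

/-- This is the symmetrization: exchanging the two copies of an edge changes the sign of that edge's
part of the difference. -/
theorem patternMatrix_swapTables (p : Fin N → Fin N → ℝ) (ε : Fin N × Fin N → Bool)
    (z : (Fin N → Fin N → unitInterval) × (Fin N → Fin N → unitInterval)) :
    patternMatrix (edgePattern p (swapTables ε z).1)
        - patternMatrix (edgePattern p (swapTables ε z).2)
      = signedSum (edgePart (patternMatrix (edgePattern p z.1)
          - patternMatrix (edgePattern p z.2))) ε := by
  rw [signedSum_edgePart]
  ext i j
  simp only [patternMatrix, edgePattern, swapTables, Matrix.sub_apply, of_apply, boolSign]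
  by_cases h : ε (min i j, max i j) = true <;> simp [h]

theorem measurable_edgePattern {Ω : Type*} [MeasurableSpace Ω] {p : Ω → Fin N → Fin N → ℝ}
    {U : Ω → Fin N → Fin N → unitInterval} (hp : ∀ a b, Measurable fun ω => p ω a b)
    (hU : Measurable U) : Measurable fun ω => edgePattern (p ω) (U ω) := by
  refine measurable_pi_lambda _ fun a => measurable_pi_lambda _ fun b => measurable_to_bool ?_
  have h1 : Measurable fun ω => (U ω a b : ℝ) := by fun_prop
  have : MeasurableSet {ω | (U ω a b : ℝ) < p ω a b} := measurableSet_lt h1 (hp a b)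
  convert this using 1
  ext ω
  simp [edgePattern]

/-- There are finitely many patterns, so an arbitrary function of them is measurable, and bounded.
All integrability questions about the noise are settled this way. -/
theorem measurable_comp_edgePattern {Ω : Type*} [MeasurableSpace Ω]
    {p p' : Ω → Fin N → Fin N → ℝ} {U U' : Ω → Fin N → Fin N → unitInterval}
    (hp : ∀ a b, Measurable fun ω => p ω a b) (hp' : ∀ a b, Measurable fun ω => p' ω a b)
    (hU : Measurable U) (hU' : Measurable U')
    (G : (Fin N → Fin N → Bool) → (Fin N → Fin N → Bool) → ℝ) :
    Measurable fun ω => G (edgePattern (p ω) (U ω)) (edgePattern (p' ω) (U' ω)) := by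
  have h : Measurable fun b : (Fin N → Fin N → Bool) × (Fin N → Fin N → Bool) => G b.1 b.2 :=
    measurable_of_finite _
  exact h.comp ((measurable_edgePattern hp hU).prodMk (measurable_edgePattern hp' hU'))

theorem exists_bound_pattern (G : (Fin N → Fin N → Bool) → (Fin N → Fin N → Bool) → ℝ) :
    ∃ C, ∀ b b', ‖G b b'‖ ≤ C := by
  obtain ⟨C, hC⟩ := (Set.finite_range fun b : (Fin N → Fin N → Bool) × (Fin N → Fin N → Bool) =>
    ‖G b.1 b.2‖).bddAbove
  exact ⟨C, fun b b' => hC ⟨(b, b'), rfl⟩⟩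

theorem integrable_comp_edgePattern {Ω : Type*} [MeasurableSpace Ω] {m : Measure Ω}
    [IsFiniteMeasure m] (p : Fin N → Fin N → ℝ) {U U' : Ω → Fin N → Fin N → unitInterval}
    (hU : Measurable U) (hU' : Measurable U')
    (G : (Fin N → Fin N → Bool) → (Fin N → Fin N → Bool) → ℝ) :
    Integrable (fun ω => G (edgePattern p (U ω)) (edgePattern p (U' ω))) m := by
  obtain ⟨C, hC⟩ := exists_bound_pattern G
  exact Integrable.of_bound (measurable_comp_edgePattern (p := fun _ => p) (p' := fun _ => p)
    (fun _ _ => measurable_const) (fun _ _ => measurable_const) hU hU' G).aestronglyMeasurable C (ae_of_all _ fun _ => hC _ _)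

theorem integral_edge_indicator {q : ℝ} (h0 : 0 ≤ q) (h1 : q ≤ 1) :
    ∫ u : unitInterval, (if (u : ℝ) < q then (1 : ℝ) else 0) = q := by
  have h : (fun u : unitInterval => if (u : ℝ) < q then (1 : ℝ) else 0)
      = (Set.Iio (⟨q, h0, h1⟩ : unitInterval)).indicator fun _ => 1 := by
    ext u
    simp [Set.indicator_apply, ← Subtype.coe_lt_coe]
  rw [h, integral_indicator measurableSet_Iio]
  simp [measureReal_def, unitInterval.volume_Iio, h0]

theorem integral_patternMatrix {p : Fin N → Fin N → ℝ} (hsymm : ∀ i j, p i j = p j i)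
    (h0 : ∀ i j, 0 ≤ p i j) (h1 : ∀ i j, p i j ≤ 1) (i j : Fin N) :
    ∫ U, patternMatrix (edgePattern p U) i j ∂(tableLaw N) = p i j := by
  have hp : p (min i j) (max i j) = p i j := by
    rcases le_total i j with h | h
    · rw [min_eq_left h, max_eq_right h]
    · rw [min_eq_right h, max_eq_left h, hsymm]
  have e1 : MeasurePreserving (fun U : Fin N → Fin N → unitInterval => U (min i j))
      (tableLaw N) (Measure.pi fun _ => volume) :=
    measurePreserving_eval (fun _ : Fin N => Measure.pi fun _ : Fin N =>
      (volume : Measure unitInterval)) (min i j)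
  have e2 : MeasurePreserving (fun U : Fin N → unitInterval => U (max i j))
      (Measure.pi fun _ => volume) volume :=
    measurePreserving_eval (fun _ : Fin N => (volume : Measure unitInterval)) (max i j)
  have e := e2.comp e1
  rw [← hp, ← integral_edge_indicator (h0 (min i j) (max i j)) (h1 _ _), ← e.map_eq,
    integral_map e.measurable.aemeasurable]
  · simp [patternMatrix, edgePattern]
  · refine Measurable.aestronglyMeasurable ?_
    exact Measurable.ite (measurableSet_lt (by fun_prop) measurable_const) measurable_const
      measurable_const

theorem integral_exp_table_le {f : Fin N → Fin N → unitInterval → ℝ}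
    (hf : ∀ a b, Measurable (f a b)) (h0 : ∀ a b u, 0 ≤ f a b u) (h1 : ∀ a b u, f a b u ≤ 1)
    (t : ℝ) :
    ∫ U, Real.exp (t * ∑ a, ∑ b, f a b (U a b)) ∂(tableLaw N)
      ≤ Real.exp (∑ a, ∑ b, (Real.exp t - 1) * ∫ u, f a b u) := by
  refine integral_exp_sum_le (f := fun a (W : Fin N → unitInterval) => ∑ b, f a b (W b))
    fun a => ?_
  exact integral_exp_sum_le fun b => integral_exp_mul_le (hf a b) (h0 a b) (h1 a b) t

/-- The number of edges at the vertex `i`. -/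
def patternDegree (b : Fin N → Fin N → Bool) (i : Fin N) : ℝ := ∑ j, patternMatrix b i j

/-- The degree reads only the upper triangle; it is bounded by counting row `i` and column `i` in
full. Each cell gets weight `1/2` per incidence with `i`, to stay in `[0, 1]` with total mean `∑ⱼ
pᵢⱼ`, and the Chernoff parameter `2` compensates; `7` bounds `exp 2 - 1`. -/
theorem integral_exp_patternDegree_le {p : Fin N → Fin N → ℝ} (hsymm : ∀ i j, p i j = p j i)
    (h0 : ∀ i j, 0 ≤ p i j) (h1 : ∀ i j, p i j ≤ 1) {ρ : ℝ} {i : Fin N}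
    (hρ : ∑ j, p i j ≤ ρ) :
    ∫ U, Real.exp (patternDegree (edgePattern p U) i) ∂(tableLaw N) ≤ Real.exp (7 * ρ) := by
  let w : Fin N → Fin N → ℝ := fun a b => ((if a = i then 1 else 0) + (if b = i then 1 else 0)) / 2
  have hw0 : ∀ a b, 0 ≤ w a b := fun a b => by simp only [w]; split_ifs <;> norm_num
  have hw1 : ∀ a b, w a b ≤ 1 := fun a b => by simp only [w]; split_ifs <;> norm_num
  let f : Fin N → Fin N → unitInterval → ℝ := fun a b u =>
    w a b * (if (u : ℝ) < p a b then 1 else 0)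
  have hdeg : ∀ U, patternDegree (edgePattern p U) i ≤ 2 * ∑ a, ∑ b, f a b (U a b) := by
    intro U
    have hf : 2 * ∑ a, ∑ b, f a b (U a b) = ∑ j, ((if (U i j : ℝ) < p i j then 1 else 0)
        + (if (U j i : ℝ) < p j i then 1 else 0)) := by
      have : ∀ a b, 2 * f a b (U a b) = (if a = i then (if (U a b : ℝ) < p a b then 1 else 0) else 0)
          + (if b = i then (if (U a b : ℝ) < p a b then 1 else 0) else 0) := by
        intro a b
        simp only [f, w]
        split_ifs <;> norm_num
      simp only [Finset.mul_sum, this, Finset.sum_add_distrib]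
      congr 1
      · rw [Finset.sum_comm]
        simp
      · simp
    rw [hf]
    refine Finset.sum_le_sum fun j _ => ?_
    simp only [patternMatrix, edgePattern, of_apply, decide_eq_true_eq]
    rcases le_total i j with h | h
    · rw [min_eq_left h, max_eq_right h]
      split_ifs <;> norm_num
    · rw [min_eq_right h, max_eq_left h]
      split_ifs <;> norm_num
  have hint : ∀ a b, ∫ u, f a b u = w a b * p a b := fun a b => by
    simp only [f]
    rw [integral_const_mul, integral_edge_indicator (h0 a b) (h1 a b)]
  have hsum : ∑ a, ∑ b, (Real.exp 2 - 1) * ∫ u, f a b u ≤ 7 * ρ := by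
    have hE : Real.exp 2 - 1 ≤ 7 := by
      have h := Real.exp_one_lt_d9
      have h2 : Real.exp 2 = Real.exp 1 * Real.exp 1 := by rw [← Real.exp_add]; norm_num
      have h3 := Real.exp_pos 1
      nlinarith
    have hs : ∑ a, ∑ b, w a b * p a b = ∑ j, p i j := by
      have : ∀ a b, w a b * p a b = (if a = i then p a b / 2 else 0)
          + (if b = i then p a b / 2 else 0) := by
        intro a b
        simp only [w]
        split_ifs <;> ring
      simp only [this, Finset.sum_add_distrib]
      rw [Finset.sum_comm]
      simp only [Finset.sum_ite_eq', Finset.mem_univ, if_true]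
      rw [← Finset.sum_add_distrib]
      refine Finset.sum_congr rfl fun j _ => ?_
      rw [hsymm j i]
      ring
    simp only [hint, ← Finset.mul_sum, hs]
    have : 0 ≤ ∑ j, p i j := Finset.sum_nonneg fun j _ => h0 i j
    nlinarith
  have hmeas : ∀ a b, Measurable (f a b) := fun a b =>
    (Measurable.ite (measurableSet_lt (by fun_prop) measurable_const) measurable_const
      measurable_const).const_mul _
  have hf0 : ∀ a b u, 0 ≤ f a b u := fun a b u => by
    have := hw0 a b
    simp only [f]
    split_ifs <;> simp [this]
  have hf1 : ∀ a b u, f a b u ≤ 1 := fun a b u => by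
    have := hw1 a b
    simp only [f]
    split_ifs <;> simp [this]
  refine le_trans ?_ ((integral_exp_table_le hmeas hf0 hf1 2).trans (Real.exp_le_exp.mpr hsum))
  refine integral_mono_of_nonneg (ae_of_all _ fun U => (Real.exp_pos _).le) ?_
    (ae_of_all _ fun U => Real.exp_le_exp.mpr (hdeg U))
  refine Integrable.of_bound (C := Real.exp (2 * ∑ a : Fin N, ∑ b : Fin N, 1)) ?_ ?_
  · refine Measurable.aestronglyMeasurable ?_
    refine Real.measurable_exp.comp (Measurable.const_mul ?_ _)
    refine Finset.measurable_sum _ fun a _ => Finset.measurable_sum _ fun b _ => ?_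
    exact (hmeas a b).comp (by fun_prop)
  · refine ae_of_all _ fun U => ?_
    rw [Real.norm_eq_abs, abs_of_nonneg (Real.exp_pos _).le]
    gcongr with a _ b _
    exact hf1 a b _

end

end Table

/-! ### Operator bound for the noise by symmetrization -/

section NoiseBound

noncomputable section

variable {N : ℕ}

/-- A bound for the numerical radius of `m` that is trivial if some row of `m` is large, and that
comes from the trace of an even power of `m` otherwise. -/
def radiusBound (D s : ℝ) (k : ℕ) (m : Matrix (Fin N) (Fin N) ℝ) : ℝ :=
  if ∀ i, ∑ j, m i j ^ 2 ≤ D then s + s * ((m ^ (2 * k)).trace / s ^ (2 * k)) else N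

theorem abs_dotProduct_mulVec_le_card {m : Matrix (Fin N) (Fin N) ℝ} (hm : ∀ i j, |m i j| ≤ 1)
    {u : Fin N → ℝ} (hu : u ⬝ᵥ u = 1) : |u ⬝ᵥ (m *ᵥ u)| ≤ N := by
  have h1 : |u ⬝ᵥ (m *ᵥ u)| ≤ ∑ i, ∑ j, |u i| * |u j| := by
    simp only [dotProduct, mulVec, Finset.mul_sum]
    refine (Finset.abs_sum_le_sum_abs _ _).trans (Finset.sum_le_sum fun i _ => ?_)
    refine (Finset.abs_sum_le_sum_abs _ _).trans (Finset.sum_le_sum fun j _ => ?_)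
    rw [abs_mul, abs_mul]
    have := mul_le_mul_of_nonneg_right (hm i j) (abs_nonneg (u j))
    rw [one_mul] at this
    exact mul_le_mul_of_nonneg_left this (abs_nonneg _)
  have h2 : ∑ i, ∑ j, |u i| * |u j| = (∑ i, |u i|) ^ 2 := by
    rw [pow_two, Finset.sum_mul_sum]
  have h3 : (∑ i, |u i|) ^ 2 ≤ N * ∑ i, |u i| ^ 2 := by
    simpa using sq_sum_le_card_mul_sum_sq (s := (Finset.univ : Finset (Fin N))) (f := fun i => |u i|)
  have h4 : ∑ i, |u i| ^ 2 = 1 := by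
    rw [← hu, dotProduct]
    exact Finset.sum_congr rfl fun i _ => by rw [sq_abs, pow_two]
  rw [h4, mul_one] at h3
  linarith

theorem abs_dotProduct_mulVec_le_radiusBound {m : Matrix (Fin N) (Fin N) ℝ} (hm : mᵀ = m)
    (hm1 : ∀ i j, |m i j| ≤ 1) {D s : ℝ} (hs : 0 < s) {k : ℕ} (hk : 1 ≤ k) {u : Fin N → ℝ}
    (hu : u ⬝ᵥ u = 1) : |u ⬝ᵥ (m *ᵥ u)| ≤ radiusBound D s k m := by
  rw [radiusBound]
  split_ifs
  · exact abs_dotProduct_mulVec_le_trace_pow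
      (by rw [IsHermitian, conjTranspose_eq_transpose_of_trivial, hm]) hs hk hu
  · exact abs_dotProduct_mulVec_le_card hm1 hu

theorem radiusBound_nonneg {m : Matrix (Fin N) (Fin N) ℝ} (hm : mᵀ = m) {D s : ℝ} (hs : 0 < s)
    (k : ℕ) : 0 ≤ radiusBound D s k m := by
  rw [radiusBound]
  split_ifs
  · have : 0 ≤ (m ^ (2 * k)).trace := Finset.sum_nonneg fun i _ => diag_pow_even_nonneg hm k i
    positivity
  · positivity

/-- Signs do not affect squared entries, so whether all row sums are at most `D` is the same for
every `ε`: either Khintchine applies to the whole average or the trivial bound `N` does. -/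
theorem sum_radiusBound_signedSum_le {m : Matrix (Fin N) (Fin N) ℝ} (hm : mᵀ = m) {D s : ℝ}
    (hD : 0 ≤ D) (hs : 0 < s) (k : ℕ) :
    ∑ ε : Fin N × Fin N → Bool, radiusBound D s k (signedSum (edgePart m) ε)
      ≤ Fintype.card (Fin N × Fin N → Bool) * (s + s * (N * (2 * k * D / s ^ 2) ^ k)
          + if ∀ i, ∑ j, m i j ^ 2 ≤ D then 0 else (N : ℝ)) := by
  have hrow : ∀ (ε : Fin N × Fin N → Bool) i, ∑ j, signedSum (edgePart m) ε i j ^ 2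
      = ∑ j, m i j ^ 2 := by
    intro ε i
    rw [signedSum_edgePart]
    refine Finset.sum_congr rfl fun j _ => ?_
    rw [of_apply, mul_pow, pow_two, boolSign_mul_self, one_mul]
  simp only [radiusBound, hrow]
  split_ifs with h
  · rw [add_zero, Finset.sum_add_distrib, ← Finset.mul_sum, ← Finset.sum_div]
    have hK := sum_trace_signedSum_pow_le (edgePart_transpose hm) (sum_edgePart_mul_self hm) hD h k
    have : (2 * k * D / s ^ 2) ^ k = (2 * k * D) ^ k / s ^ (2 * k) := by
      rw [div_pow, ← pow_mul]
    rw [this, Finset.sum_const, Finset.card_univ, nsmul_eq_mul]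
    calc _ ≤ (Fintype.card (Fin N × Fin N → Bool) : ℝ) * s
          + s * ((Fintype.card (Fin N × Fin N → Bool) * (N * (2 * k * D) ^ k)) / s ^ (2 * k)) := by
            gcongr
      _ = _ := by ring
  · rw [Finset.sum_const, Finset.card_univ, nsmul_eq_mul]
    have : 0 ≤ s + s * (N * (2 * k * D / s ^ 2) ^ k) := by positivity
    gcongr
    linarith

theorem abs_sub_patternMatrix_le (b b' : Fin N → Fin N → Bool) (i j : Fin N) :
    |(patternMatrix b - patternMatrix b') i j| ≤ 1 := by
  simp only [patternMatrix, Matrix.sub_apply, of_apply]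
  split_ifs <;> norm_num

theorem sub_patternMatrix_transpose (b b' : Fin N → Fin N → Bool) :
    (patternMatrix b - patternMatrix b')ᵀ = patternMatrix b - patternMatrix b' := by
  rw [transpose_sub, patternMatrix_transpose, patternMatrix_transpose]

/-- If a row of the difference of two patterns is large, one of the degrees is large. -/
theorem ite_row_le_sum_exp_patternDegree (b b' : Fin N → Fin N → Bool) (D : ℝ) :
    (if ∀ i, ∑ j, (patternMatrix b - patternMatrix b') i j ^ 2 ≤ D then 0 else (N : ℝ))
      ≤ N * ∑ i, (Real.exp (-(D / 2)) * Real.exp (patternDegree b i)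
          + Real.exp (-(D / 2)) * Real.exp (patternDegree b' i)) := by
  split_ifs with h
  · positivity
  · push Not at h
    obtain ⟨i, hi⟩ := h
    refine le_mul_of_one_le_right (by positivity) ?_
    refine le_trans ?_ (Finset.single_le_sum (f := fun i => Real.exp (-(D / 2))
      * Real.exp (patternDegree b i) + Real.exp (-(D / 2)) * Real.exp (patternDegree b' i))
      (fun i _ => by positivity) (Finset.mem_univ i))
    have hle : ∑ j, (patternMatrix b - patternMatrix b') i j ^ 2
        ≤ patternDegree b i + patternDegree b' i := by
      rw [patternDegree, patternDegree, ← Finset.sum_add_distrib]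
      refine Finset.sum_le_sum fun j _ => ?_
      simp only [patternMatrix, Matrix.sub_apply, of_apply]
      split_ifs <;> norm_num
    simp only [← Real.exp_add]
    rcases le_total (D / 2) (patternDegree b i) with h1 | h1
    · have := Real.one_le_exp (x := -(D / 2) + patternDegree b i) (by linarith)
      have := Real.exp_pos (-(D / 2) + patternDegree b' i)
      linarith
    · have := Real.one_le_exp (x := -(D / 2) + patternDegree b' i) (by linarith)
      have := Real.exp_pos (-(D / 2) + patternDegree b i)
      linarith

/-- The bound for the deviation of the adjacency matrix from its mean, obtained by averaging over
an independent copy. -/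
def noiseBound (p : Fin N → Fin N → ℝ) (D s : ℝ) (k : ℕ) (U : Fin N → Fin N → unitInterval) : ℝ :=
  ∫ U', radiusBound D s k (patternMatrix (edgePattern p U) - patternMatrix (edgePattern p U'))
    ∂(tableLaw N)

/-- The matrix `p` is the mean over an independent copy, so the quadratic form is an average of
forms of differences and its absolute value moves inside. The bound does not involve `u`: it
controls all directions at once. -/
theorem abs_dotProduct_noise_le_noiseBound {p : Fin N → Fin N → ℝ} (hsymm : ∀ i j, p i j = p j i)
    (h0 : ∀ i j, 0 ≤ p i j) (h1 : ∀ i j, p i j ≤ 1) {D s : ℝ} (hs : 0 < s) {k : ℕ} (hk : 1 ≤ k)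
    {u : Fin N → ℝ} (hu : u ⬝ᵥ u = 1) (U : Fin N → Fin N → unitInterval) :
    |u ⬝ᵥ ((patternMatrix (edgePattern p U) - Matrix.of p) *ᵥ u)| ≤ noiseBound p D s k U := by
  have hform : ∀ m : Matrix (Fin N) (Fin N) ℝ, u ⬝ᵥ (m *ᵥ u) = ∑ i, ∑ j, u i * u j * m i j := by
    intro m
    simp only [dotProduct, mulVec, Finset.mul_sum]
    exact Finset.sum_congr rfl fun i _ => Finset.sum_congr rfl fun j _ => by ring
  have hint : ∀ i j, Integrable (fun U' => u i * u j *
      (patternMatrix (edgePattern p U) - patternMatrix (edgePattern p U')) i j) (tableLaw N) :=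
    fun i j => integrable_comp_edgePattern p measurable_const measurable_id fun b b' =>
      u i * u j * (patternMatrix b - patternMatrix b') i j
  have hint' : ∀ i j, Integrable (fun U' => patternMatrix (edgePattern p U') i j) (tableLaw N) :=
    fun i j => integrable_comp_edgePattern p measurable_id measurable_id fun b _ =>
      patternMatrix b i j
  have hmean : u ⬝ᵥ ((patternMatrix (edgePattern p U) - Matrix.of p) *ᵥ u)
      = ∫ U', u ⬝ᵥ ((patternMatrix (edgePattern p U) - patternMatrix (edgePattern p U')) *ᵥ u)
        ∂(tableLaw N) := by
    simp only [hform]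
    rw [integral_finsetSum _ fun i _ => integrable_finsetSum _ fun j _ => hint i j]
    refine Finset.sum_congr rfl fun i _ => ?_
    rw [integral_finsetSum _ fun j _ => hint i j]
    refine Finset.sum_congr rfl fun j _ => ?_
    rw [integral_const_mul]
    simp only [Matrix.sub_apply]
    rw [integral_sub (integrable_const _) (hint' i j), integral_patternMatrix hsymm h0 h1]
    simp
  rw [hmean, noiseBound, ← Real.norm_eq_abs]
  refine (norm_integral_le_integral_norm _).trans ?_
  refine integral_mono_of_nonneg (ae_of_all _ fun _ => norm_nonneg _) ?_ (ae_of_all _ fun U' => ?_)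
  · exact integrable_comp_edgePattern p measurable_const measurable_id fun b b' =>
      radiusBound D s k (patternMatrix b - patternMatrix b')
  · exact abs_dotProduct_mulVec_le_radiusBound (sub_patternMatrix_transpose _ _)
      (abs_sub_patternMatrix_le _ _) hs hk hu

theorem noiseBound_nonneg {p : Fin N → Fin N → ℝ} {D s : ℝ} (hs : 0 < s) (k : ℕ)
    (U : Fin N → Fin N → unitInterval) : 0 ≤ noiseBound p D s k U :=
  integral_nonneg fun _ => radiusBound_nonneg (sub_patternMatrix_transpose _ _) hs k

/-- The law of the pair of tables is invariant under every exchange, so the integrand may be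
replaced by its average over all sign patterns. The last term accounts for exceptionally large
degrees. -/
theorem integral_noiseBound_le {p : Fin N → Fin N → ℝ} (hsymm : ∀ i j, p i j = p j i)
    (h0 : ∀ i j, 0 ≤ p i j) (h1 : ∀ i j, p i j ≤ 1) {ρ : ℝ} (hρ : ∀ i, ∑ j, p i j ≤ ρ)
    {D s : ℝ} (hD : 0 ≤ D) (hs : 0 < s) (k : ℕ) :
    ∫ U, noiseBound p D s k U ∂(tableLaw N)
      ≤ s + s * (N * (2 * k * D / s ^ 2) ^ k) + 2 * N ^ 2 * Real.exp (7 * ρ - D / 2) := by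
  set ν := tableLaw N
  let F : (Fin N → Fin N → unitInterval) × (Fin N → Fin N → unitInterval) → ℝ := fun z =>
    radiusBound D s k (patternMatrix (edgePattern p z.1) - patternMatrix (edgePattern p z.2))
  have hF : Integrable F (ν.prod ν) :=
    integrable_comp_edgePattern p measurable_fst measurable_snd fun b b' =>
      radiusBound D s k (patternMatrix b - patternMatrix b')
  have hswap : ∀ ε, Integrable (fun z => F (swapTables ε z)) (ν.prod ν) := fun ε =>
    (measurePreserving_swapTables ε).integrable_comp_of_integrable hF
  have hprod : ∫ U, noiseBound p D s k U ∂ν = ∫ z, F z ∂(ν.prod ν) := by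
    rw [integral_prod _ hF]
    rfl
  let card : ℝ := Fintype.card (Fin N × Fin N → Bool)
  have hcard : 0 < card := by
    simp only [card]
    exact_mod_cast Fintype.card_pos
  have havg : card * ∫ z, F z ∂(ν.prod ν) = ∫ z, ∑ ε, F (swapTables ε z) ∂(ν.prod ν) := by
    rw [integral_finsetSum _ fun ε _ => hswap ε]
    have : ∀ ε, ∫ z, F (swapTables ε z) ∂(ν.prod ν) = ∫ z, F z ∂(ν.prod ν) := by
      intro ε
      have hmap := (measurePreserving_swapTables ε (N := N)).map_eq
      rw [← integral_map (measurePreserving_swapTables ε).measurable.aemeasurable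
        (by rw [hmap]; exact hF.aestronglyMeasurable), hmap]
    simp only [this, Finset.sum_const, Finset.card_univ, nsmul_eq_mul, card]
  set A := s + s * (N * (2 * k * D / s ^ 2) ^ k)
  let G : (Fin N → Fin N → unitInterval) × (Fin N → Fin N → unitInterval) → ℝ := fun z =>
    card * (A + N * ∑ i, (Real.exp (-(D / 2)) * Real.exp (patternDegree (edgePattern p z.1) i)
      + Real.exp (-(D / 2)) * Real.exp (patternDegree (edgePattern p z.2) i)))
  have hpt : ∀ z, ∑ ε, F (swapTables ε z) ≤ G z := by
    intro z
    simp only [F, patternMatrix_swapTables]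
    refine (sum_radiusBound_signedSum_le (sub_patternMatrix_transpose _ _) hD hs k).trans ?_
    refine mul_le_mul_of_nonneg_left ?_ hcard.le
    exact add_le_add le_rfl (ite_row_le_sum_exp_patternDegree _ _ _)
  have hG : Integrable G (ν.prod ν) :=
    integrable_comp_edgePattern p measurable_fst measurable_snd fun b b' =>
      card * (A + N * ∑ i, (Real.exp (-(D / 2)) * Real.exp (patternDegree b i)
        + Real.exp (-(D / 2)) * Real.exp (patternDegree b' i)))
  have hd1 : ∀ i, Integrable (fun z : (Fin N → Fin N → unitInterval) ×
      (Fin N → Fin N → unitInterval) => Real.exp (-(D / 2)) *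
        Real.exp (patternDegree (edgePattern p z.1) i)) (ν.prod ν) := fun i =>
    integrable_comp_edgePattern p measurable_fst measurable_snd fun b _ =>
      Real.exp (-(D / 2)) * Real.exp (patternDegree b i)
  have hd2 : ∀ i, Integrable (fun z : (Fin N → Fin N → unitInterval) ×
      (Fin N → Fin N → unitInterval) => Real.exp (-(D / 2)) *
        Real.exp (patternDegree (edgePattern p z.2) i)) (ν.prod ν) := fun i =>
    integrable_comp_edgePattern p measurable_fst measurable_snd fun _ b =>
      Real.exp (-(D / 2)) * Real.exp (patternDegree b i)
  have hd : ∀ i, Integrable (fun z : (Fin N → Fin N → unitInterval) ×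
      (Fin N → Fin N → unitInterval) => Real.exp (-(D / 2)) *
        Real.exp (patternDegree (edgePattern p z.1) i) + Real.exp (-(D / 2)) *
        Real.exp (patternDegree (edgePattern p z.2) i)) (ν.prod ν) := fun i =>
    (hd1 i).add (hd2 i)
  have hGint : ∫ z, G z ∂(ν.prod ν) ≤ card * (A + 2 * N ^ 2 * Real.exp (7 * ρ - D / 2)) := by
    simp only [G]
    rw [integral_const_mul]
    refine mul_le_mul_of_nonneg_left ?_ hcard.le
    rw [integral_add (integrable_const _) ((integrable_finsetSum _ fun i _ => hd i).const_mul _),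
      integral_const_mul, integral_finsetSum _ fun i _ => hd i]
    have hone : ∀ i, ∫ z, (Real.exp (-(D / 2)) * Real.exp (patternDegree (edgePattern p z.1) i)
        + Real.exp (-(D / 2)) * Real.exp (patternDegree (edgePattern p z.2) i)) ∂(ν.prod ν)
        ≤ 2 * Real.exp (7 * ρ - D / 2) := by
      intro i
      rw [integral_add (hd1 i) (hd2 i), integral_const_mul, integral_const_mul,
        integral_fun_fst (fun U => Real.exp (patternDegree (edgePattern p U) i)),
        integral_fun_snd (fun U => Real.exp (patternDegree (edgePattern p U) i))]
      have := integral_exp_patternDegree_le hsymm h0 h1 (hρ i)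
      rw [sub_eq_add_neg, Real.exp_add]
      simp only [probReal_univ, one_smul]
      have h3 := mul_le_mul_of_nonneg_left this (Real.exp_pos (-(D / 2))).le
      linarith
    have hsum := Finset.sum_le_sum fun i (_ : i ∈ Finset.univ) => hone i
    rw [Finset.sum_const, Finset.card_univ, Fintype.card_fin, nsmul_eq_mul] at hsum
    have := mul_le_mul_of_nonneg_left hsum (Nat.cast_nonneg (α := ℝ) N)
    simp only [integral_const, probReal_univ, one_smul]
    nlinarith
  rw [hprod]
  refine le_of_mul_le_mul_left ?_ hcard
  rw [havg]
  exact (integral_mono (integrable_finsetSum _ fun ε _ => hswap ε) hG hpt).trans hGint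

theorem measurable_noiseBound {Ω : Type*} [MeasurableSpace Ω] {p : Ω → Fin N → Fin N → ℝ}
    (hp : ∀ a b, Measurable fun ω => p ω a b) (D s : ℝ) (k : ℕ) :
    Measurable fun ω : Ω × (Fin N → Fin N → unitInterval) => noiseBound (p ω.1) D s k ω.2 := by
  have h := measurable_comp_edgePattern
    (Ω := (Ω × (Fin N → Fin N → unitInterval)) × (Fin N → Fin N → unitInterval))
    (p := fun z => p z.1.1) (p' := fun z => p z.1.1) (U := fun z => z.1.2) (U' := fun z => z.2)
    (fun a b => (hp a b).comp (measurable_fst.comp measurable_fst))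
    (fun a b => (hp a b).comp (measurable_fst.comp measurable_fst))
    (measurable_snd.comp measurable_fst) measurable_snd
    fun b b' => radiusBound D s k (patternMatrix b - patternMatrix b')
  exact (h.stronglyMeasurable.integral_prod_right (ν := tableLaw N)).measurable

theorem integrable_noiseBound {p : Fin N → Fin N → ℝ} {D s : ℝ} {k : ℕ} :
    Integrable (noiseBound p D s k) (tableLaw N) := by
  have hF : Integrable (fun z : (Fin N → Fin N → unitInterval) × (Fin N → Fin N → unitInterval) =>
      radiusBound D s k (patternMatrix (edgePattern p z.1) - patternMatrix (edgePattern p z.2)))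
      ((tableLaw N).prod (tableLaw N)) :=
    integrable_comp_edgePattern p measurable_fst measurable_snd fun b b' =>
      radiusBound D s k (patternMatrix b - patternMatrix b')
  exact hF.integral_prod_left

theorem tableLaw_noiseBound_ge_le {p : Fin N → Fin N → ℝ} (hsymm : ∀ i j, p i j = p j i)
    (h0 : ∀ i j, 0 ≤ p i j) (h1 : ∀ i j, p i j ≤ 1) {ρ : ℝ} (hρ : ∀ i, ∑ j, p i j ≤ ρ)
    {D s t : ℝ} (hD : 0 ≤ D) (hs : 0 < s) (ht : 0 < t) (k : ℕ) :
    tableLaw N {U | t ≤ noiseBound p D s k U} ≤ ENNReal.ofReal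
      ((s + s * (N * (2 * k * D / s ^ 2) ^ k) + 2 * N ^ 2 * Real.exp (7 * ρ - D / 2)) / t) := by
  have h := mul_meas_ge_le_integral_of_nonneg
    (ae_of_all (tableLaw N) fun U => noiseBound_nonneg (p := p) (D := D) hs k U)
    integrable_noiseBound t
  have h2 := h.trans (integral_noiseBound_le hsymm h0 h1 hρ hD hs k)
  rw [← ofReal_measureReal]
  refine ENNReal.ofReal_le_ofReal ?_
  rw [le_div_iff₀ ht, mul_comm]
  exact h2

end

end NoiseBound

/-! ### Row sums of a kernel at independent random positions -/

section Positions

variable {α ι : Type*}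

theorem measurePreserving_update [MeasurableSpace α] [Fintype ι] [DecidableEq ι]
    {m : Measure α} [IsProbabilityMeasure m] (i : ι) :
    MeasurePreserving (fun z : α × (ι → α) => Function.update z.2 i z.1)
      (m.prod (Measure.pi fun _ => m)) (Measure.pi fun _ => m) := by
  have hmeas : Measurable fun z : α × (ι → α) => Function.update z.2 i z.1 := by
    refine measurable_pi_lambda _ fun j => ?_
    by_cases h : j = i
    · subst h
      simpa using measurable_fst
    · simp only [Function.update_of_ne h]
      fun_prop
  refine ⟨hmeas, (Measure.pi_eq fun s hs => ?_).symm⟩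
  rw [Measure.map_apply hmeas (MeasurableSet.univ_pi hs)]
  have hpre : (fun z : α × (ι → α) => Function.update z.2 i z.1) ⁻¹' Set.univ.pi s
      = s i ×ˢ Set.univ.pi (Function.update s i Set.univ) := by
    ext z
    simp only [Set.mem_preimage, Set.mem_pi, Set.mem_univ, true_implies, Set.mem_prod]
    constructor
    · intro h
      refine ⟨by simpa using h i, fun j => ?_⟩
      by_cases hj : j = i
      · subst hj; simp
      · simpa [Function.update_of_ne hj] using h j
    · rintro ⟨h1, h2⟩ j
      by_cases hj : j = i
      · subst hj; simpa using h1
      · simpa [Function.update_of_ne hj] using h2 j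
  rw [hpre, Measure.prod_prod, Measure.pi_pi, ← Finset.mul_prod_erase _ _ (Finset.mem_univ i),
    ← Finset.mul_prod_erase Finset.univ (fun j => m (s j)) (Finset.mem_univ i)]
  simp only [Function.update_self, measure_univ, one_mul]
  congr 1
  exact Finset.prod_congr rfl fun j hj => by
    rw [Function.update_of_ne (Finset.ne_of_mem_erase hj)]

/-- Conditioning on coordinate `i`: once it is fixed at `y`, a row of the kernel is a sum of
independent variables. -/
theorem integral_pi_le_of_update [MeasurableSpace α] [Fintype ι] [DecidableEq ι]
    {m : Measure α} [IsProbabilityMeasure m] {F : (ι → α) → ℝ} (i : ι) {B : ℝ}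
    (hF : Integrable F (Measure.pi fun _ => m))
    (hB : ∀ y, ∫ x, F (Function.update x i y) ∂(Measure.pi fun _ => m) ≤ B) :
    ∫ x, F x ∂(Measure.pi fun _ => m) ≤ B := by
  have h := measurePreserving_update (m := m) i
  have hF' : Integrable (fun z : α × (ι → α) => F (Function.update z.2 i z.1))
      (m.prod (Measure.pi fun _ => m)) := h.integrable_comp_of_integrable hF
  rw [← h.map_eq, integral_map h.measurable.aemeasurable
    (by rw [h.map_eq]; exact hF.aestronglyMeasurable),
    integral_prod _ hF']
  calc _ ≤ ∫ _, B ∂m := integral_mono hF'.integral_prod_left (integrable_const _) hB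
    _ = B := by simp

variable {k : α → α → ℝ} {β : ℝ}

theorem kernelRow_mem [DecidableEq ι] (h0 : ∀ y z, 0 ≤ k y z) (h1 : ∀ y z, k y z ≤ 1) (i j : ι)
    (y z : α) : 0 ≤ (if i = j then 0 else k y z) ∧ (if i = j then 0 else k y z) ≤ 1 := by
  split_ifs
  · norm_num
  · exact ⟨h0 _ _, h1 _ _⟩

theorem measurable_kernelRow [MeasurableSpace α] [DecidableEq ι] (hk : Measurable (Function.uncurry k)) (i j : ι) :
    Measurable fun x : ι → α => if i = j then 0 else k (x i) (x j) := by
  split_ifs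
  · exact measurable_const
  · exact hk.comp (Measurable.prodMk (measurable_pi_apply i) (measurable_pi_apply j))

theorem kernelRow_update [DecidableEq ι] (i : ι) (x : ι → α) (y : α) (j : ι) :
    (if i = j then 0 else k (Function.update x i y i) (Function.update x i y j))
      = if i = j then 0 else k y (x j) := by
  split_ifs with h
  · rfl
  · rw [Function.update_self, Function.update_of_ne (Ne.symm h)]

theorem measure_kernelRow_ge_le [MeasurableSpace α] [Fintype ι] [DecidableEq ι]
    {m : Measure α} [IsProbabilityMeasure m] (hk : Measurable (Function.uncurry k)) (h0 : ∀ y z, 0 ≤ k y z)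
    (h1 : ∀ y z, k y z ≤ 1) (hβ : ∀ y, ∫ z, k y z ∂m ≤ β) (hβ0 : 0 ≤ β) (i : ι) {t : ℝ}
    (ht : 0 ≤ t) (a : ℝ) :
    (Measure.pi fun _ : ι => m).real {x | a ≤ ∑ j, if i = j then 0 else k (x i) (x j)}
      ≤ Real.exp ((Real.exp t - 1) * (Fintype.card ι * β) - t * a) := by
  have hmeas : Measurable fun x : ι → α => ∑ j, if i = j then 0 else k (x i) (x j) :=
    Finset.measurable_sum _ fun j _ => measurable_kernelRow hk i j
  have hint : Integrable (fun x : ι → α => Real.exp (t * ∑ j, if i = j then 0 else k (x i) (x j)))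
      (Measure.pi fun _ => m) := by
    refine Integrable.of_bound (Real.measurable_exp.comp (hmeas.const_mul t)).aestronglyMeasurable
      (Real.exp (t * ∑ _j : ι, 1)) (ae_of_all _ fun x => ?_)
    rw [Real.norm_eq_abs, abs_of_nonneg (Real.exp_pos _).le]
    gcongr with j _
    exact (kernelRow_mem h0 h1 i j _ _).2
  have hmgf : ∫ x : ι → α, Real.exp (t * ∑ j, if i = j then 0 else k (x i) (x j))
      ∂(Measure.pi fun _ => m) ≤ Real.exp ((Real.exp t - 1) * (Fintype.card ι * β)) := by
    refine integral_pi_le_of_update i hint fun y => ?_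
    simp only [kernelRow_update]
    have h := integral_exp_sum_le (ι := ι) (m := fun _ => m) (t := t)
      (f := fun j z => if i = j then 0 else k y z)
      (c := fun _ => (Real.exp t - 1) * β) fun j => by
        refine (integral_exp_mul_le (m := m) (f := fun z => if i = j then 0 else k y z) ?_
          (fun z => (kernelRow_mem h0 h1 i j y z).1)
          (fun z => (kernelRow_mem h0 h1 i j y z).2) t).trans ?_
        · split_ifs
          · exact measurable_const
          · exact hk.comp measurable_prodMk_left
        · refine Real.exp_le_exp.mpr (mul_le_mul_of_nonneg_left ?_
            (sub_nonneg.mpr (Real.one_le_exp ht)))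
          split_ifs
          · simpa using hβ0
          · exact hβ y
    refine h.trans (le_of_eq ?_)
    rw [Finset.sum_const, Finset.card_univ, nsmul_eq_mul]
    congr 1
    ring
  refine (measure_ge_le_exp_mul_mgf a ht hint).trans ?_
  rw [mgf, sub_eq_add_neg, add_comm, Real.exp_add, neg_mul]
  gcongr

/-- A signed row sum of the kernel has second moment of the order of its diagonal part if the
signs are balanced. -/
theorem integral_sq_signed_kernelRow_le [MeasurableSpace α] [Fintype ι] [DecidableEq ι]
    {m : Measure α} [IsProbabilityMeasure m] (hk : Measurable (Function.uncurry k))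
    (h0 : ∀ y z, 0 ≤ k y z) (h1 : ∀ y z, k y z ≤ 1) (hβ : ∀ y, ∫ z, k y z ∂m ≤ β)
    {s : ι → ℝ} {a : ℝ} (hs : ∑ j, s j = 0) (hsa : ∀ j, s j ^ 2 = a)
    (hcard : 2 ≤ Fintype.card ι) (i : ι) :
    ∫ x : ι → α, (∑ j, (if i = j then 0 else k (x i) (x j)) * s j) ^ 2 ∂(Measure.pi fun _ => m)
      ≤ a * (Fintype.card ι * β) := by
  have hmeas : Measurable fun x : ι → α => ∑ j, (if i = j then 0 else k (x i) (x j)) * s j :=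
    Finset.measurable_sum _ fun j _ => (measurable_kernelRow hk i j).mul_const _
  have hbd : ∀ x : ι → α, |∑ j, (if i = j then 0 else k (x i) (x j)) * s j| ≤ ∑ j, |s j| := by
    intro x
    refine (Finset.abs_sum_le_sum_abs _ _).trans (Finset.sum_le_sum fun j _ => ?_)
    have h := kernelRow_mem h0 h1 i j (x i) (x j)
    rw [abs_mul, abs_of_nonneg h.1]
    exact mul_le_of_le_one_left (abs_nonneg _) h.2
  have hint : Integrable (fun x : ι → α =>
      (∑ j, (if i = j then 0 else k (x i) (x j)) * s j) ^ 2) (Measure.pi fun _ => m) := by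
    refine Integrable.of_bound (hmeas.pow_const 2).aestronglyMeasurable ((∑ j, |s j|) ^ 2) (ae_of_all _ fun x => ?_)
    rw [Real.norm_eq_abs, abs_pow]
    exact pow_le_pow_left₀ (abs_nonneg _) (hbd x) 2
  refine integral_pi_le_of_update i hint fun y => ?_
  simp only [kernelRow_update]
  have hky : Measurable (k y) := hk.comp measurable_prodMk_left
  have hkL : MemLp (k y) 2 m := MemLp.of_bound hky.aestronglyMeasurable 1
    (ae_of_all _ fun z => by rw [Real.norm_eq_abs, abs_of_nonneg (h0 y z)]; exact h1 y z)
  set X : ι → α → ℝ := fun j z => (if i = j then 0 else k y z) * s j with hX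
  have hXL : ∀ j, MemLp (X j) 2 m := by
    intro j
    by_cases h : i = j
    · simp [hX, h]
    · simp only [hX, if_neg h]
      exact hkL.mul_const _
  set μ := ∫ z, k y z ∂m with hμ
  set b := ∫ z, k y z ^ 2 ∂m with hb
  have hμb : μ ^ 2 ≤ b := by
    have := variance_nonneg (k y) m
    rw [variance_eq_sub hkL] at this
    simpa using this
  have hbμ : b ≤ β := by
    refine le_trans (integral_mono hkL.integrable_sq (hkL.integrable one_le_two) fun z => ?_) (hβ y)
    have := h0 y z
    have := h1 y z
    change k y z ^ 2 ≤ k y z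
    nlinarith
  have hmean : ∀ j, ∫ z, X j z ∂m = (if i = j then 0 else μ) * s j := by
    intro j
    simp only [hX]
    rw [integral_mul_const]
    split_ifs
    · simp
    · rfl
  have hvar : ∀ j, Var[X j; m] = if i = j then 0 else a * (b - μ ^ 2) := by
    intro j
    have hXj : X j = fun z => (if i = j then 0 else k y z) * s j := rfl
    split_ifs with h
    · rw [hXj]
      simp only [if_pos h, zero_mul]
      exact variance_zero m
    · rw [hXj]
      simp only [if_neg h]
      rw [variance_mul_const, variance_eq_sub hkL, hsa j]
      simp [hb, hμ, mul_comm]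
  have hS := variance_sum_pi (μ := fun _ : ι => m) hXL
  have hSL : MemLp (∑ j, fun x : ι → α => X j (x j)) 2 (Measure.pi fun _ => m) :=
    memLp_finsetSum' _ fun j _ => (hXL j).comp_measurePreserving (measurePreserving_eval _ j)
  rw [variance_eq_sub hSL] at hS
  have hsq : ∫ x : ι → α, ((∑ j, fun x : ι → α => X j (x j)) ^ 2) x ∂(Measure.pi fun _ => m)
      = ∫ x : ι → α, (∑ j, (if i = j then 0 else k y (x j)) * s j) ^ 2
        ∂(Measure.pi fun _ => m) := by
    simp [hX]
  -- The signs sum to zero and only index `i` is missing from the row, so the mean is a single term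
  -- instead of one of order `N`.
  have hone : ∫ x : ι → α, (∑ j, fun x : ι → α => X j (x j)) x ∂(Measure.pi fun _ => m)
      = -(μ * s i) := by
    simp only [Finset.sum_apply]
    have hXi : ∀ j, Integrable (fun x : ι → α => X j (x j)) (Measure.pi fun _ => m) := fun j =>
      ((hXL j).comp_measurePreserving (measurePreserving_eval (fun _ => m) j)).integrable one_le_two
    rw [integral_finsetSum _ fun j _ => hXi j]
    have : ∀ j, ∫ x : ι → α, X j (x j) ∂(Measure.pi fun _ => m) = ∫ z, X j z ∂m := fun j => by
      have h := measurePreserving_eval (fun _ : ι => m) j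
      rw [← integral_map (φ := fun x : ι → α => x j) h.measurable.aemeasurable
        (by rw [h.map_eq]; exact (hXL j).aestronglyMeasurable), h.map_eq]
    simp only [this, hmean]
    rw [← Finset.add_sum_erase _ _ (Finset.mem_univ i)] at hs ⊢
    rw [if_pos rfl, zero_mul, zero_add, Finset.sum_congr rfl fun j hj => by
      rw [if_neg (Finset.ne_of_mem_erase hj).symm], ← Finset.mul_sum]
    rw [eq_neg_of_add_eq_zero_right hs]
    ring
  rw [hsq, hone] at hS
  have hvsum : ∑ j, Var[X j; m] = (Fintype.card ι - 1) * (a * (b - μ ^ 2)) := by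
    simp only [hvar]
    rw [← Finset.add_sum_erase _ _ (Finset.mem_univ i), if_pos rfl, zero_add,
      Finset.sum_congr rfl fun j hj => if_neg (Finset.ne_of_mem_erase hj).symm, Finset.sum_const,
      Finset.card_erase_of_mem (Finset.mem_univ i), Finset.card_univ, nsmul_eq_mul,
      Nat.cast_sub (by omega), Nat.cast_one]
  rw [hvsum] at hS
  have ha : 0 ≤ a := by rw [← hsa i]; positivity
  have hc : (2 : ℝ) ≤ Fintype.card ι := by exact_mod_cast hcard
  have e : (-(μ * s i)) ^ 2 = a * μ ^ 2 := by rw [← hsa i]; ring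
  rw [e, sub_eq_iff_eq_add] at hS
  rw [hS]
  -- Variance plus squared mean; the leftover coefficient of `μ²` is `-(N - 2)`, which can be
  -- dropped as `N ≥ 2`.
  have : (Fintype.card ι - 1) * (a * (b - μ ^ 2)) + a * μ ^ 2
      = a * (Fintype.card ι * b - b - (Fintype.card ι - 2) * μ ^ 2) := by ring
  rw [this]
  refine mul_le_mul_of_nonneg_left ?_ ha
  have h3 : 0 ≤ b := (sq_nonneg μ).trans hμb
  have h4 : 0 ≤ (Fintype.card ι - 2) * μ ^ 2 := mul_nonneg (by linarith) (sq_nonneg _)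
  have h5 : (Fintype.card ι : ℝ) * b ≤ Fintype.card ι * β :=
    mul_le_mul_of_nonneg_left hbμ (by linarith)
  linarith

end Positions

/-! ### Mean of the Gaussian kernel -/

section GaussianKernel

theorem integral_exp_neg_mul_sq_sub_gaussianReal_le {γ : ℝ} (hγ : 0 < γ) (y : ℝ) :
    ∫ x, Real.exp (-γ * (y - x) ^ 2) ∂(gaussianReal 0 1) ≤ √(1 / (2 * γ)) := by
  rw [integral_gaussianReal_eq_integral_smul one_ne_zero]
  have hint : Integrable fun x : ℝ => Real.exp (-γ * (y - x) ^ 2) :=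
    (integrable_exp_neg_mul_sq hγ).comp_sub_left y
  calc ∫ x, gaussianPDFReal 0 1 x • Real.exp (-γ * (y - x) ^ 2)
      ≤ ∫ x, (√(2 * Real.pi))⁻¹ * Real.exp (-γ * (y - x) ^ 2) := by
        refine integral_mono_of_nonneg (ae_of_all _ fun x => ?_) (hint.const_mul _)
          (ae_of_all _ fun x => ?_)
        · exact mul_nonneg (gaussianPDFReal_nonneg _ _ _) (Real.exp_pos _).le
        · simp only [smul_eq_mul]
          refine mul_le_mul_of_nonneg_right ?_ (Real.exp_pos _).le
          rw [gaussianPDFReal_def]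
          simp only [NNReal.coe_one, mul_one]
          refine mul_le_of_le_one_right (by positivity) (Real.exp_le_one_iff.mpr ?_)
          have := sq_nonneg (x - 0)
          linarith
    _ = (√(2 * Real.pi))⁻¹ * √(Real.pi / γ) := by
        rw [integral_const_mul, integral_sub_left_eq_self (fun x => Real.exp (-γ * x ^ 2)),
          integral_gaussian]
    _ = √(1 / (2 * γ)) := by
        rw [← Real.sqrt_inv, ← Real.sqrt_mul (by positivity)]
        congr 1
        have := Real.pi_pos
        field_simp

/-- Kernel and law factor over the two coordinates. In each, the density is at most `1 / √(2π)` and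
the kernel has integral `√(π / γ)`. -/
theorem integral_gaussianKernel_le {γ : ℝ} (hγ : 0 < γ) (y : EuclideanSpace ℝ (Fin 2)) :
    ∫ z, Real.exp (-γ * ‖y - z‖ ^ 2) ∂(stdGaussian (EuclideanSpace ℝ (Fin 2)))
      ≤ 1 / (2 * γ) := by
  rw [← map_pi_eq_stdGaussian, integral_map (by fun_prop)
    (Continuous.aestronglyMeasurable (by fun_prop))]
  have h : ∀ x : Fin 2 → ℝ, Real.exp (-γ * ‖y - WithLp.toLp 2 x‖ ^ 2)
      = ∏ i, Real.exp (-γ * (y i - x i) ^ 2) := by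
    intro x
    rw [← Real.exp_sum, EuclideanSpace.real_norm_sq_eq, Finset.mul_sum]
    simp
  simp only [h]
  rw [integral_fintype_prod_eq_prod (f := fun i t => Real.exp (-γ * (y i - t) ^ 2))]
  calc _ ≤ ∏ _i : Fin 2, √(1 / (2 * γ)) :=
        Finset.prod_le_prod (fun i _ => integral_nonneg fun _ => (Real.exp_pos _).le)
          fun i _ => integral_exp_neg_mul_sq_sub_gaussianReal_le hγ (y i)
    _ = 1 / (2 * γ) := by
        rw [Finset.prod_const, Finset.card_univ, Fintype.card_fin, Real.sq_sqrt (by positivity)]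

end GaussianKernel

/-! ### From quadratic forms to norms, and from row sums to quadratic forms -/

theorem sq_norm_mulVec_le_of_quadratic {N : ℕ} {W : Matrix (Fin N) (Fin N) ℝ} (hW : W.IsHermitian)
    {η : ℝ} (h : ∀ u : Fin N → ℝ, u ⬝ᵥ u = 1 → |u ⬝ᵥ (W *ᵥ u)| ≤ η) (v : Fin N → ℝ) :
    (W *ᵥ v) ⬝ᵥ (W *ᵥ v) ≤ η ^ 2 * (v ⬝ᵥ v) := by
  obtain ⟨V, hV, hV', hd⟩ := exists_spectral_decomposition hW
  have hk : ∀ k : Fin N, |sortedEigenvalue W k| ≤ η := by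
    intro k
    have hc : Vᵀ *ᵥ (V *ᵥ Pi.single k 1) = Pi.single k 1 := by
      rw [mulVec_mulVec, hV', one_mulVec]
    have h1 := h (V *ᵥ Pi.single k 1) (by
      rw [← dotProduct_transpose_mulVec hV, hc]; simp)
    rw [dotProduct_mulVec_decomposition hV hV' hd, hc,
      Finset.sum_eq_single k (fun j _ hj => by simp [Pi.single_eq_of_ne hj]) (by simp)] at h1
    simpa using h1
  rw [dotProduct_self_decomposition hV, dotProduct_self_decomposition hV v, Finset.mul_sum]
  refine Finset.sum_le_sum fun k _ => ?_
  rw [transpose_mulVec_decomposition hV' hd, mul_pow]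
  refine mul_le_mul_of_nonneg_right ?_ (sq_nonneg _)
  rw [← sq_abs]
  exact pow_le_pow_left₀ (abs_nonneg _) (hk k) 2

theorem abs_dotProduct_mulVec_le_of_unit {N : ℕ} {W : Matrix (Fin N) (Fin N) ℝ} {η : ℝ}
    (h : ∀ u : Fin N → ℝ, u ⬝ᵥ u = 1 → |u ⬝ᵥ (W *ᵥ u)| ≤ η) (u : Fin N → ℝ) :
    |u ⬝ᵥ (W *ᵥ u)| ≤ η * (u ⬝ᵥ u) := by
  have hnn : 0 ≤ u ⬝ᵥ u := Finset.sum_nonneg fun i _ => mul_self_nonneg _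
  rcases hnn.eq_or_lt with h0 | hpos
  · have : u = 0 := dotProduct_self_eq_zero.mp h0.symm
    subst this
    simp
  · set r := √(u ⬝ᵥ u) with hr
    have hr0 : 0 < r := Real.sqrt_pos.mpr hpos
    have hr2 : r ^ 2 = u ⬝ᵥ u := Real.sq_sqrt hnn
    have h1 := h (r⁻¹ • u) (by
      rw [smul_dotProduct, dotProduct_smul, ← hr2, smul_eq_mul, smul_eq_mul]
      field_simp)
    rw [mulVec_smul, smul_dotProduct, dotProduct_smul, smul_eq_mul, smul_eq_mul, ← mul_assoc,
      abs_mul, abs_of_pos (by positivity)] at h1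
    rw [← hr2]
    have h2 := mul_le_mul_of_nonneg_left h1 (sq_nonneg r)
    calc |u ⬝ᵥ (W *ᵥ u)| = r ^ 2 * (r⁻¹ * r⁻¹ * |u ⬝ᵥ (W *ᵥ u)|) := by field_simp
      _ ≤ _ := h2.trans (le_of_eq (mul_comm _ _))

/-- The quadratic form of a symmetric nonnegative matrix is bounded by its row sums. -/
theorem dotProduct_mulVec_le_of_row_sum_le {N : ℕ} {P : Matrix (Fin N) (Fin N) ℝ}
    (hP : ∀ i j, P i j = P j i) (h0 : ∀ i j, 0 ≤ P i j) {B : ℝ} (hB : ∀ i, ∑ j, P i j ≤ B)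
    (u : Fin N → ℝ) : u ⬝ᵥ (P *ᵥ u) ≤ B * (u ⬝ᵥ u) := by
  have h1 : u ⬝ᵥ (P *ᵥ u) ≤ ∑ i, ∑ j, (P i j * u i ^ 2 / 2 + P i j * u j ^ 2 / 2) := by
    simp only [dotProduct, mulVec, Finset.mul_sum]
    refine Finset.sum_le_sum fun i _ => Finset.sum_le_sum fun j _ => ?_
    have := mul_nonneg (h0 i j) (sq_nonneg (u i - u j))
    nlinarith
  have h2 : ∑ i, ∑ j, P i j * u j ^ 2 / 2 = ∑ i, ∑ j, P i j * u i ^ 2 / 2 := by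
    rw [Finset.sum_comm]
    exact Finset.sum_congr rfl fun i _ => Finset.sum_congr rfl fun j _ => by rw [hP]
  simp only [Finset.sum_add_distrib] at h1
  rw [h2] at h1
  refine h1.trans ?_
  rw [dotProduct, Finset.mul_sum, ← Finset.sum_add_distrib]
  refine Finset.sum_le_sum fun i _ => ?_
  rw [← Finset.sum_div, ← Finset.sum_mul]
  have := mul_le_mul_of_nonneg_right (hB i) (sq_nonneg (u i))
  nlinarith

/-! ### The model: decomposition of the adjacency matrix and the deterministic argument -/

section Model

variable {n : ℕ} {θ : Params}

theorem geomMatrix_symm (x : Latent n) (i j : Fin (2 * n)) :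
    geomMatrix n θ x i j = geomMatrix n θ x j i := by
  simp only [geomMatrix, of_apply, eq_comm (a := i), norm_sub_rev (x i)]

theorem geomMatrix_nonneg (x : Latent n) (i j : Fin (2 * n)) : 0 ≤ geomMatrix n θ x i j := by
  simp only [geomMatrix, of_apply]
  split_ifs
  · exact le_rfl
  · exact (Real.exp_pos _).le

theorem geomMatrix_le_one (hγ : 0 ≤ θ.γ) (x : Latent n) (i j : Fin (2 * n)) :
    geomMatrix n θ x i j ≤ 1 := by
  simp only [geomMatrix, of_apply]
  split_ifs
  · norm_num
  · rw [Real.exp_le_one_iff, neg_mul, neg_nonpos]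
    positivity

theorem blockProb_symm (i j : Fin (2 * n)) : blockProb n θ i j = blockProb n θ j i := by
  simp only [blockProb, iff_comm]

/-- The block matrix has rank at most two: `p₁` and `p₂` are `(λ₁ ± λ₂) / N`. The formula covers the
diagonal too, with value `p₁`, hence the later correction `loop - p1`. -/
theorem blockProb_eq (i j : Fin (2 * n)) :
    blockProb n θ i j
      = lam1 n θ / (2 * n : ℕ) + lam2 n θ * (communityVec n i * communityVec n j) := by
  have hn : (0 : ℝ) < (2 * n : ℕ) := by
    have := i.2
    exact_mod_cast (by omega : 0 < 2 * n)
  have h : 1 / √((2 * n : ℕ) : ℝ) * (1 / √((2 * n : ℕ) : ℝ)) = 1 / (2 * n : ℕ) := by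
    rw [← pow_two, div_pow, Real.sq_sqrt hn.le, one_pow]
  simp only [blockProb, communityVec, lam1, lam2]
  by_cases hi : (i : ℕ) < n <;> by_cases hj : (j : ℕ) < n <;>
    simp only [hi, hj, if_true, if_false, iff_true, iff_false, not_true, mul_neg,
      neg_mul, neg_neg, h] <;> field_simp <;> ring

theorem edgeProb_symm (x : Latent n) (i j : Fin (2 * n)) :
    edgeProb n θ x i j = edgeProb n θ x j i := by
  simp only [edgeProb, eq_comm (a := i), geomMatrix_symm x i j, blockProb_symm i j]

theorem blockProb_mem (hθ : θ.Admissible) (i j : Fin (2 * n)) :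
    0 ≤ blockProb n θ i j ∧ blockProb n θ i j ≤ max θ.p1 θ.p2 := by
  rw [blockProb]
  split_ifs
  · exact ⟨hθ.p1_pos.le, le_max_left _ _⟩
  · exact ⟨hθ.p2_pos.le, le_max_right _ _⟩

theorem edgeProb_nonneg (hθ : θ.Admissible) (x : Latent n) (i j : Fin (2 * n)) :
    0 ≤ edgeProb n θ x i j := by
  rw [edgeProb]
  split_ifs
  · exact hθ.loop_nonneg
  · exact add_nonneg (mul_nonneg hθ.κ_nonneg (geomMatrix_nonneg x i j)) (blockProb_mem hθ i j).1

theorem edgeProb_le_one (hθ : θ.Admissible) (hγ : 0 ≤ θ.γ) (x : Latent n) (i j : Fin (2 * n)) :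
    edgeProb n θ x i j ≤ 1 := by
  rw [edgeProb]
  split_ifs
  · exact hθ.loop_le_one
  · have h1 := mul_le_of_le_one_right hθ.κ_nonneg (geomMatrix_le_one hγ x i j)
    have h2 := (blockProb_mem (n := n) hθ i j).2
    have := hθ.max_add_le_one
    linarith

theorem adjMatrix_eq_patternMatrix (ω : Sample n) :
    adjMatrix n θ ω = patternMatrix (edgePattern (edgeProb n θ ω.1) ω.2) := by
  ext i j
  have h : edgeProb n θ ω.1 (min i j) (max i j) = edgeProb n θ ω.1 i j := by
    rcases le_total i j with h | h
    · rw [min_eq_left h, max_eq_right h]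
    · rw [min_eq_right h, max_eq_left h, edgeProb_symm]
  simp only [adjMatrix, patternMatrix, edgePattern, of_apply, h, decide_eq_true_eq]

theorem adjMatrix_isHermitian (ω : Sample n) : (adjMatrix n θ ω).IsHermitian := by
  rw [IsHermitian, conjTranspose_eq_transpose_of_trivial, adjMatrix_eq_patternMatrix,
    patternMatrix_transpose]

theorem lam1_pos (hθ : θ.Admissible) (hn : 0 < n) : 0 < lam1 n θ := by
  have h1 := hθ.p1_pos
  have h2 := hθ.p2_pos
  rw [lam1]
  positivity

theorem Params.Admissible.κ_le_one (hθ : θ.Admissible) : θ.κ ≤ 1 := by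
  have := hθ.max_add_le_one
  have := le_max_left θ.p1 θ.p2
  have := hθ.p1_pos
  linarith

theorem Params.Admissible.abs_loop_sub_le (hθ : θ.Admissible) : |θ.loop - θ.p1| ≤ 1 := by
  have := hθ.max_add_le_one
  have := le_max_left θ.p1 θ.p2
  have := hθ.p1_pos
  have := hθ.κ_nonneg
  have := hθ.loop_nonneg
  have := hθ.loop_le_one
  rw [abs_le]
  constructor <;> linarith

theorem edgeProb_eq (x : Latent n) (i j : Fin (2 * n)) :
    edgeProb n θ x i j = lam1 n θ / (2 * n : ℕ)
      + lam2 n θ * (communityVec n i * communityVec n j) + θ.κ * geomMatrix n θ x i j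
      + if i = j then θ.loop - θ.p1 else 0 := by
  rw [← blockProb_eq, edgeProb]
  split_ifs with h
  · subst h
    simp [blockProb, geomMatrix]
  · ring

theorem sum_edgeProb_le (hθ : θ.Admissible) (x : Latent n) (i : Fin (2 * n)) :
    ∑ j, edgeProb n θ x i j ≤ lam1 n θ + θ.κ * ∑ j, geomMatrix n θ x i j + 1 := by
  have hn : ((2 * n : ℕ) : ℝ) ≠ 0 := by
    have := i.2
    exact_mod_cast (by omega : 2 * n ≠ 0)
  simp only [edgeProb_eq, Finset.sum_add_distrib, ← Finset.mul_sum, sum_communityVec]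
  rw [Finset.sum_const, Finset.card_univ, Fintype.card_fin, nsmul_eq_mul, mul_div_cancel₀ _ hn]
  have := (abs_le.mp hθ.abs_loop_sub_le).2
  simp only [mul_zero, add_zero, Finset.sum_ite_eq, Finset.mem_univ, if_true]
  linarith

theorem adjMatrix_mulVec (ω : Sample n) (u : Fin (2 * n) → ℝ) (i : Fin (2 * n)) :
    (adjMatrix n θ ω *ᵥ u) i = lam1 n θ / (2 * n : ℕ) * ∑ j, u j
      + lam2 n θ * (communityVec n ⬝ᵥ u) * communityVec n i
      + θ.κ * (geomMatrix n θ ω.1 *ᵥ u) i + (θ.loop - θ.p1) * u i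
      + ((adjMatrix n θ ω - Matrix.of (edgeProb n θ ω.1)) *ᵥ u) i := by
  have h : ((Matrix.of (edgeProb n θ ω.1)) *ᵥ u) i = lam1 n θ / (2 * n : ℕ) * ∑ j, u j
      + lam2 n θ * (communityVec n ⬝ᵥ u) * communityVec n i
      + θ.κ * (geomMatrix n θ ω.1 *ᵥ u) i + (θ.loop - θ.p1) * u i := by
    simp only [mulVec, dotProduct, of_apply, edgeProb_eq, add_mul, Finset.sum_add_distrib, ite_mul,
      zero_mul, Finset.sum_ite_eq, Finset.mem_univ, if_true, Finset.mul_sum, Finset.sum_mul]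
    congr 1
    congr 1
    · congr 1
      exact Finset.sum_congr rfl fun j _ => by ring
    · exact Finset.sum_congr rfl fun j _ => by ring
  rw [← h, ← Pi.add_apply, ← add_mulVec, add_sub_cancel]

/-- The deterministic part of the argument: row sum, cross term and noise bounds force the second
eigenvector to be close to the community vector. -/
theorem sq_correlation_ge_of_bounds (hθ : θ.Admissible) (hn : 0 < n) {ω : Sample n} {C τ : ℝ}
    (hτ : 0 < τ) (hτC : 6 * τ < 1 - C) (hC : 0 ≤ C) (hlam2 : 0 < lam2 n θ)
    (hlam : lam2 n θ ≤ C * lam1 n θ)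
    (hdiag : 1 ≤ τ * lam2 n θ)
    (hrow : ∀ i, θ.κ * ∑ j, geomMatrix n θ ω.1 i j ≤ (C + τ) * lam2 n θ)
    (hcross : θ.κ ^ 2 * ∑ i, (geomMatrix n θ ω.1 *ᵥ communityVec n) i ^ 2 ≤ (τ * lam2 n θ) ^ 2)
    (hnoise : ∀ u : Fin (2 * n) → ℝ, u ⬝ᵥ u = 1 →
      |u ⬝ᵥ ((adjMatrix n θ ω - Matrix.of (edgeProb n θ ω.1)) *ᵥ u)| ≤ τ * lam2 n θ)
    {w : Fin (2 * n) → ℝ} (hw : IsSecondEigenvector (adjMatrix n θ ω) w) :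
    1 - (3 * τ / (1 - C - 3 * τ)) ^ 2 ≤ (w ⬝ᵥ communityVec n) ^ 2 := by
  set A := adjMatrix n θ ω
  set P := geomMatrix n θ ω.1
  set W := A - Matrix.of (edgeProb n θ ω.1) with hWdef
  set ℓ := lam2 n θ
  set v := communityVec n
  have hA : A.IsHermitian := adjMatrix_isHermitian ω
  have hW : W.IsHermitian := by
    refine hA.sub ?_
    rw [IsHermitian, conjTranspose_eq_transpose_of_trivial]
    ext i j
    exact edgeProb_symm _ _ _
  have hv : v ⬝ᵥ v = 1 := communityVec_dotProduct_self hn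
  have hNpos : (0 : ℝ) < (2 * n : ℕ) := by exact_mod_cast (by omega : 0 < 2 * n)
  have hloop := abs_le.mp hθ.abs_loop_sub_le
  have hnoise' := abs_dotProduct_mulVec_le_of_unit hnoise
  have hquad : ∀ u : Fin (2 * n) → ℝ, u ⬝ᵥ (A *ᵥ u) = lam1 n θ / (2 * n : ℕ) * (∑ j, u j) ^ 2
      + ℓ * (v ⬝ᵥ u) ^ 2 + θ.κ * (u ⬝ᵥ (P *ᵥ u)) + (θ.loop - θ.p1) * (u ⬝ᵥ u)
      + u ⬝ᵥ (W *ᵥ u) := by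
    intro u
    have h1 : u ⬝ᵥ (A *ᵥ u) = ∑ i, u i * (lam1 n θ / (2 * n : ℕ) * ∑ j, u j
      + ℓ * (v ⬝ᵥ u) * v i + θ.κ * (P *ᵥ u) i + (θ.loop - θ.p1) * u i + (W *ᵥ u) i) :=
      Finset.sum_congr rfl fun i _ => by rw [adjMatrix_mulVec]
    have e1 : (∑ j, u j) ^ 2 = ∑ i, u i * ∑ j, u j := by rw [pow_two, Finset.sum_mul]
    have e2 : (v ⬝ᵥ u) ^ 2 = ∑ i, v i * u i * (v ⬝ᵥ u) := by
      rw [pow_two, ← Finset.sum_mul]; rfl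
    rw [h1, e1, e2]
    have hd : ∀ a b : Fin (2 * n) → ℝ, a ⬝ᵥ b = ∑ i, a i * b i := fun _ _ => rfl
    rw [hd u (P *ᵥ u), hd u u, hd u (W *ᵥ u)]
    simp only [Finset.mul_sum, ← Finset.sum_add_distrib]
    refine Finset.sum_congr rfl fun i _ => ?_
    simp only [mul_add, Finset.mul_sum]
    congr 1
    congr 1
    · congr 1
      · congr 1
        · exact Finset.sum_congr rfl fun j _ => by ring
        · ring
      · ring
    · ring
  -- Since `v` is orthogonal to the constants, the residual is `κ P v`, the diagonal correction and
  -- the noise, each of norm at most `τ ℓ`.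
  have hres : (A *ᵥ v - ℓ • v) ⬝ᵥ (A *ᵥ v - ℓ • v) ≤ (3 * τ * ℓ) ^ 2 := by
    have hcoord : ∀ i, (A *ᵥ v - ℓ • v) i
        = θ.κ * (P *ᵥ v) i + (θ.loop - θ.p1) * v i + (W *ᵥ v) i := by
      intro i
      rw [Pi.sub_apply, adjMatrix_mulVec, Pi.smul_apply, smul_eq_mul, sum_communityVec, hv]
      ring
    have hW2 := sq_norm_mulVec_le_of_quadratic hW hnoise v
    rw [hv, mul_one] at hW2
    have hD : ∑ i, ((θ.loop - θ.p1) * v i) ^ 2 ≤ 1 := by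
      simp only [mul_pow, ← Finset.mul_sum]
      have : ∑ i, v i ^ 2 = 1 := by
        rw [← hv]; exact Finset.sum_congr rfl fun i _ => pow_two _
      rw [this, mul_one]
      nlinarith [hloop.1, hloop.2]
    have hP2 : ∑ i, (θ.κ * (P *ᵥ v) i) ^ 2 ≤ (τ * ℓ) ^ 2 := by
      simp only [mul_pow θ.κ, ← Finset.mul_sum]
      exact hcross
    have hW3 : ∑ i, (W *ᵥ v) i ^ 2 ≤ (τ * ℓ) ^ 2 := by
      refine le_of_eq_of_le ?_ hW2
      exact Finset.sum_congr rfl fun i _ => pow_two _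
    calc (A *ᵥ v - ℓ • v) ⬝ᵥ (A *ᵥ v - ℓ • v)
        ≤ ∑ i, 3 * ((θ.κ * (P *ᵥ v) i) ^ 2 + ((θ.loop - θ.p1) * v i) ^ 2 + (W *ᵥ v) i ^ 2) := by
          refine Finset.sum_le_sum fun i _ => ?_
          rw [hcoord]
          generalize θ.κ * (P *ᵥ v) i = a
          generalize (θ.loop - θ.p1) * v i = b
          generalize (W *ᵥ v) i = c
          nlinarith [sq_nonneg (a - b), sq_nonneg (b - c), sq_nonneg (a - c)]
      _ ≤ (3 * τ * ℓ) ^ 2 := by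
          rw [← Finset.mul_sum, Finset.sum_add_distrib, Finset.sum_add_distrib]
          nlinarith
  have hlam1 : (1 - C) * ℓ ≤ lam1 n θ - ℓ := by
    have h1 := lam1_pos hθ hn
    have h2 : ℓ ≤ lam1 n θ := by nlinarith
    have h3 := mul_le_mul_of_nonneg_left h2 (by linarith : 0 ≤ 1 - C)
    linarith
  -- Test vector: the constant one. The kernel contributes nonnegatively; the diagonal and the noise
  -- cost at most `τ ℓ` each.
  have htop : ℓ + (1 - C - 3 * τ) * ℓ ≤ sortedEigenvalue A 0 := by
    have h1 := dotProduct_mulVec_le_sortedEigenvalue hA (fun _ => 1)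
    have hone : (fun _ : Fin (2 * n) => (1 : ℝ)) ⬝ᵥ (fun _ => 1) = (2 * n : ℕ) := by
      simp [dotProduct]
    have hv1 : v ⬝ᵥ (fun _ => (1 : ℝ)) = 0 := by
      simpa [dotProduct] using sum_communityVec n
    have hP1 : 0 ≤ (fun _ : Fin (2 * n) => (1 : ℝ)) ⬝ᵥ (P *ᵥ fun _ => 1) := by
      simp only [dotProduct, mulVec, one_mul, mul_one]
      exact Finset.sum_nonneg fun i _ => Finset.sum_nonneg fun j _ => geomMatrix_nonneg _ _ _
    have hW1 := (abs_le.mp (hnoise' fun _ => 1)).1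
    have hs : ∑ _j : Fin (2 * n), (1 : ℝ) = (2 * n : ℕ) := by simp
    rw [hquad, hone, hv1, hs] at h1
    rw [hone] at hW1
    have e : lam1 n θ / (2 * n : ℕ) * ((2 * n : ℕ) : ℝ) ^ 2 = lam1 n θ * (2 * n : ℕ) := by
      field_simp
    rw [e] at h1
    have hκP := mul_nonneg hθ.κ_nonneg hP1
    have hl := mul_le_mul_of_nonneg_right hloop.1 hNpos.le
    have hτN := mul_le_mul_of_nonneg_right hdiag hNpos.le
    have : (lam1 n θ - 2 * (τ * ℓ)) * (2 * n : ℕ) ≤ sortedEigenvalue A 0 * (2 * n : ℕ) := by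
      linarith
    have h2 := le_of_mul_le_mul_right this hNpos
    have : 0 ≤ τ * ℓ := by positivity
    linarith
  -- Off the two block eigenvectors only the kernel `(C + τ) ℓ`, the diagonal `τ ℓ` and the noise `τ
  -- ℓ` remain, in total `(C + 3 τ) ℓ`.
  have hlow : ∀ k, 2 ≤ k → k < 2 * n → sortedEigenvalue A k ≤ ℓ - (1 - C - 3 * τ) * ℓ := by
    intro k hk hkn
    refine sortedEigenvalue_le_of_forall_orthogonal hA (v₁ := fun _ => 1) (v₂ := v) ?_ hk hkn
    intro u hu1 hu2
    have hs : ∑ j, u j = 0 := by simpa [dotProduct] using hu1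
    rw [hquad, hs, dotProduct_comm v u, hu2]
    have hnn : 0 ≤ u ⬝ᵥ u := Finset.sum_nonneg fun i _ => mul_self_nonneg _
    have hP : θ.κ * (u ⬝ᵥ (P *ᵥ u)) ≤ (C + τ) * ℓ * (u ⬝ᵥ u) := by
      have h := dotProduct_mulVec_le_of_row_sum_le (P := θ.κ • P)
        (fun i j => congrArg (fun z => θ.κ • z) (geomMatrix_symm ω.1 i j))
        (fun i j => mul_nonneg hθ.κ_nonneg (geomMatrix_nonneg _ _ _))
        (B := (C + τ) * ℓ) (fun i => by
          simp only [Matrix.smul_apply, smul_eq_mul, ← Finset.mul_sum]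
          exact hrow i) u
      rwa [smul_mulVec, dotProduct_smul, smul_eq_mul] at h
    have hWu := (abs_le.mp (hnoise' u)).2
    have h1 : (θ.loop - θ.p1) * (u ⬝ᵥ u) ≤ τ * ℓ * (u ⬝ᵥ u) :=
      mul_le_mul_of_nonneg_right (hloop.2.trans hdiag) hnn
    nlinarith
  -- The condition `6 τ < 1 - C` says precisely that the residual is smaller than the gap.
  have h := sq_dotProduct_secondEigenvector_ge hA (by omega) hv (by positivity)
    (by nlinarith : 3 * τ * ℓ < (1 - C - 3 * τ) * ℓ) hres htop hlow hw
  rwa [mul_div_mul_right _ _ hlam2.ne'] at h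

theorem mu1_nonneg (hθ : θ.Admissible) (hn : 0 < n) (ω : Sample n) : 0 ≤ mu1 n θ ω := by
  have hH : (θ.κ • geomMatrix n θ ω.1).IsHermitian := by
    rw [IsHermitian, conjTranspose_eq_transpose_of_trivial]
    ext i j
    simp only [transpose_apply, Matrix.smul_apply]
    rw [geomMatrix_symm]
  have h := dotProduct_mulVec_le_sortedEigenvalue hH fun _ => 1
  have h0 : 0 ≤ (fun _ : Fin (2 * n) => (1 : ℝ)) ⬝ᵥ ((θ.κ • geomMatrix n θ ω.1) *ᵥ fun _ => 1) := by
    simp only [dotProduct, mulVec, one_mul, mul_one, Matrix.smul_apply, smul_eq_mul]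
    exact Finset.sum_nonneg fun i _ => Finset.sum_nonneg fun j _ =>
      mul_nonneg hθ.κ_nonneg (geomMatrix_nonneg _ _ _)
  have hone : (fun _ : Fin (2 * n) => (1 : ℝ)) ⬝ᵥ (fun _ => 1) = (2 * n : ℕ) := by
    simp [dotProduct]
  rw [hone] at h
  have hNpos : (0 : ℝ) < (2 * n : ℕ) := by exact_mod_cast (by omega : 0 < 2 * n)
  exact nonneg_of_mul_nonneg_left (h0.trans h) hNpos

/-- For `g ≤ 0` the first bracket of the equation is negative and the subtracted term is
nonnegative, so there is no root. -/
theorem IsBoundParameter.pos {q x g : ℝ} (hq : 1 < q) (hx : 0 ≤ x) (h : IsBoundParameter q x g) :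
    0 < g := by
  by_contra! hg
  rw [IsBoundParameter] at h
  have h1 : g * (q - 1) ≤ 0 := mul_nonpos_of_nonpos_of_nonneg hg (by linarith)
  have h2 : 0 ≤ (3 * q + 1) * g ^ 2 := by positivity
  have h3 : 0 ≤ x * ((3 * q + 1) * g ^ 2 - 2 * (q - 1) * g + (3 * q + 1)) :=
    mul_nonneg hx (by nlinarith)
  nlinarith

/-- With `g > 0` and `(g + 1) x ≤ 1/2`, the quotient lies in `[0, 1]` and its prefactor is at most
one, possibly negative. A correlation tending to one therefore beats the bound. -/
theorem sqCorrelationBound_le_one {q x g : ℝ} (hq : 1 < q) (hx : 0 ≤ x)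
    (h : IsBoundParameter q x g) (hg : (g + 1) * x ≤ 1 / 2) : sqCorrelationBound q x g ≤ 1 := by
  have hg0 := h.pos hq hx
  have hq1 : 0 < q - 1 := by linarith
  have ha : 0 ≤ (g + 1) * x := by positivity
  have hden : 1 ≤ (1 + (g + 1) / (2 * (q - 1)) * x + √(q * (g + 1) * x)) ^ 2 := by
    have h1 : 0 ≤ (g + 1) / (2 * (q - 1)) * x := by positivity
    have h2 := Real.sqrt_nonneg (q * (g + 1) * x)
    exact one_le_pow₀ (by linarith)
  have hnum0 : 0 ≤ (1 - (g + 1) * x) ^ 3 := pow_nonneg (by linarith) 3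
  have hnum1 : (1 - (g + 1) * x) ^ 3 ≤ 1 := pow_le_one₀ (by linarith) (by linarith)
  have hfrac0 : 0 ≤ (1 - (g + 1) * x) ^ 3
      / (1 + (g + 1) / (2 * (q - 1)) * x + √(q * (g + 1) * x)) ^ 2 := by positivity
  have hfrac1 : (1 - (g + 1) * x) ^ 3
      / (1 + (g + 1) / (2 * (q - 1)) * x + √(q * (g + 1) * x)) ^ 2 ≤ 1 :=
    (div_le_one (by linarith)).mpr (hnum1.trans hden)
  have hfac : 1 - 2 * x / (q - 1) ≤ 1 := by
    have : 0 ≤ 2 * x / (q - 1) := by positivity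
    linarith
  rw [sqCorrelationBound]
  exact (mul_le_of_le_one_left hfrac0 hfac).trans hfrac1

theorem correlationExpansion_le_one {q : ℝ} (hq : 0 ≤ q) (x : ℝ) :
    correlationExpansion q x ≤ 1 := by
  rw [correlationExpansion]
  have : 0 ≤ 2 * (q / √(q - 1)) * √x := by positivity
  linarith

end Model

/-! ### Probabilities of the bad events -/

section Events

variable {n : ℕ} {θ : Params}

theorem law_eq_prod (n : ℕ) : law n = (Measure.pi fun _ : Fin (2 * n) =>
    stdGaussian (EuclideanSpace ℝ (Fin 2))).prod (tableLaw (2 * n)) := rfl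

instance : IsProbabilityMeasure (law n) := by
  rw [law_eq_prod]
  infer_instance

theorem law_latent_le {S : Set (Latent n)} {b : ℝ}
    (h : (Measure.pi fun _ : Fin (2 * n) => stdGaussian (EuclideanSpace ℝ (Fin 2))).real S ≤ b) :
    law n {ω | ω.1 ∈ S} ≤ ENNReal.ofReal b := by
  have e : {ω : Sample n | ω.1 ∈ S} = S ×ˢ Set.univ := by
    ext ω
    simp
  rw [e, law_eq_prod, Measure.prod_prod, measure_univ, mul_one, ← ofReal_measureReal]
  exact ENNReal.ofReal_le_ofReal h

theorem measurable_gaussianKernel (γ : ℝ) : Measurable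
    (Function.uncurry fun y z : EuclideanSpace ℝ (Fin 2) => Real.exp (-γ * ‖y - z‖ ^ 2)) :=
  Continuous.measurable (by fun_prop)

theorem measurable_geomMatrix (i j : Fin (2 * n)) :
    Measurable fun x : Latent n => geomMatrix n θ x i j :=
  measurable_kernelRow (measurable_gaussianKernel θ.γ) i j

theorem measurable_edgeProb (i j : Fin (2 * n)) :
    Measurable fun x : Latent n => edgeProb n θ x i j := by
  simp only [edgeProb]
  split_ifs
  · exact measurable_const
  · exact ((measurable_geomMatrix i j).const_mul _).add_const _

theorem gaussianKernel_mem (hγ : 0 < θ.γ) (y z : EuclideanSpace ℝ (Fin 2)) :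
    Real.exp (-θ.γ * ‖y - z‖ ^ 2) ≤ 1 := by
  rw [Real.exp_le_one_iff, neg_mul, neg_nonpos]
  positivity

/-- The number `N / (2 γ)`, an upper bound for the mean row sums of the kernel matrix. -/
noncomputable def meanRow (n : ℕ) (θ : Params) : ℝ := ((2 * n : ℕ) : ℝ) * (1 / (2 * θ.γ))

theorem kappa_mul_meanRow : θ.κ * meanRow n θ = noise n θ := by
  rw [meanRow, noise]
  ring

theorem law_row_sum_ge_le (hγ : 0 < θ.γ) {τ : ℝ} (hτ : 0 < τ) (hτ1 : τ ≤ 1) :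
    law n {ω | ∃ i, (1 + τ) * meanRow n θ ≤ ∑ j, geomMatrix n θ ω.1 i j}
      ≤ ENNReal.ofReal ((2 * n : ℕ) * Real.exp (-(τ ^ 2 / 4 * meanRow n θ))) := by
  refine law_latent_le (S := {x | ∃ i, (1 + τ) * meanRow n θ ≤ ∑ j, geomMatrix n θ x i j}) ?_
  set π := Measure.pi fun _ : Fin (2 * n) => stdGaussian (EuclideanSpace ℝ (Fin 2))
  have hM : 0 ≤ meanRow n θ := by rw [meanRow]; positivity
  have hexp : Real.exp (τ / 2) - 1 ≤ τ / 2 + (τ / 2) ^ 2 := by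
    have := Real.abs_exp_sub_one_sub_id_le (x := τ / 2) (by rw [abs_le]; constructor <;> linarith)
    have := (abs_le.mp this).2
    linarith
  have hone : ∀ i, π.real {x | (1 + τ) * meanRow n θ ≤ ∑ j, geomMatrix n θ x i j}
      ≤ Real.exp (-(τ ^ 2 / 4 * meanRow n θ)) := by
    intro i
    refine (measure_kernelRow_ge_le (measurable_gaussianKernel θ.γ)
      (fun _ _ => (Real.exp_pos _).le) (gaussianKernel_mem hγ)
      -- The Chernoff parameter `τ / 2` gives the exponent `τ/2 + τ²/4 - (τ/2)(1 + τ) = -τ²/4` per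
      -- unit of the mean.
      (integral_gaussianKernel_le hγ) (by positivity) i (by positivity : 0 ≤ τ / 2)
      ((1 + τ) * meanRow n θ)).trans ?_
    rw [Fintype.card_fin]
    change Real.exp ((Real.exp (τ / 2) - 1) * meanRow n θ - τ / 2 * ((1 + τ) * meanRow n θ)) ≤ _
    refine Real.exp_le_exp.mpr ?_
    have := mul_le_mul_of_nonneg_right hexp hM
    nlinarith
  have hU : {x : Latent n | ∃ i, (1 + τ) * meanRow n θ ≤ ∑ j, geomMatrix n θ x i j}
      = ⋃ i, {x | (1 + τ) * meanRow n θ ≤ ∑ j, geomMatrix n θ x i j} := by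
    ext x
    simp
  rw [hU]
  refine (measureReal_iUnion_fintype_le _).trans ?_
  refine (Finset.sum_le_sum fun i _ => hone i).trans (le_of_eq ?_)
  rw [Finset.sum_const, Finset.card_univ, Fintype.card_fin, nsmul_eq_mul]

/-- Markov's inequality. The `N` rows contribute at most `meanRow / N` each, and `κ² ≤ κ`, so the
expected squared norm is of the order of the noise and not of its square. -/
theorem law_cross_gt_le (hθ : θ.Admissible) (hn : 0 < n) (hγ : 0 < θ.γ) {a : ℝ} (ha : 0 < a) :
    law n {ω | a < θ.κ ^ 2 * ∑ i, (geomMatrix n θ ω.1 *ᵥ communityVec n) i ^ 2}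
      ≤ ENNReal.ofReal (noise n θ / a) := by
  refine law_latent_le
    (S := {x | a < θ.κ ^ 2 * ∑ i, (geomMatrix n θ x *ᵥ communityVec n) i ^ 2}) ?_
  set π := Measure.pi fun _ : Fin (2 * n) => stdGaussian (EuclideanSpace ℝ (Fin 2))
  have hNpos : (0 : ℝ) < (2 * n : ℕ) := by exact_mod_cast (by omega : 0 < 2 * n)
  have hM : 0 ≤ meanRow n θ := by rw [meanRow]; positivity
  have hmv : ∀ (i) (x : Latent n), (geomMatrix n θ x *ᵥ communityVec n) i
      = ∑ j, geomMatrix n θ x i j * communityVec n j := fun _ _ => rfl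
  have hmeas : ∀ i, Measurable fun x : Latent n => (geomMatrix n θ x *ᵥ communityVec n) i := by
    intro i
    simp only [hmv]
    exact Finset.measurable_sum _ fun j _ => (measurable_geomMatrix i j).mul_const _
  have hbd : ∀ (i) (x : Latent n), |(geomMatrix n θ x *ᵥ communityVec n) i|
      ≤ ∑ j, |communityVec n j| := by
    intro i x
    rw [hmv]
    refine (Finset.abs_sum_le_sum_abs _ _).trans (Finset.sum_le_sum fun j _ => ?_)
    rw [abs_mul, abs_of_nonneg (geomMatrix_nonneg x i j)]
    exact mul_le_of_le_one_left (abs_nonneg _) (geomMatrix_le_one hγ.le x i j)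
  have hint : ∀ i, Integrable (fun x : Latent n => (geomMatrix n θ x *ᵥ communityVec n) i ^ 2) π := by
    intro i
    refine Integrable.of_bound ((hmeas i).pow_const 2).aestronglyMeasurable
      ((∑ j, |communityVec n j|) ^ 2) (ae_of_all _ fun x => ?_)
    rw [Real.norm_eq_abs, abs_pow]
    exact pow_le_pow_left₀ (abs_nonneg _) (hbd i x) 2
  have hI : ∫ x, θ.κ ^ 2 * ∑ i, (geomMatrix n θ x *ᵥ communityVec n) i ^ 2 ∂π ≤ noise n θ := by
    rw [integral_const_mul, integral_finsetSum _ fun i _ => hint i]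
    have hone : ∀ i, ∫ x, (geomMatrix n θ x *ᵥ communityVec n) i ^ 2 ∂π
        ≤ 1 / ((2 * n : ℕ) : ℝ) * meanRow n θ := by
      intro i
      have h := integral_sq_signed_kernelRow_le (measurable_gaussianKernel θ.γ)
        (fun _ _ => (Real.exp_pos _).le) (gaussianKernel_mem hγ) (integral_gaussianKernel_le hγ)
        (sum_communityVec n) communityVec_sq (by rw [Fintype.card_fin]; omega) i
      rw [Fintype.card_fin] at h
      exact h
    have hs := Finset.sum_le_sum fun i (_ : i ∈ Finset.univ) => hone i
    rw [Finset.sum_const, Finset.card_univ, Fintype.card_fin, nsmul_eq_mul, ← mul_assoc,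
      mul_one_div_cancel hNpos.ne', one_mul] at hs
    rw [← kappa_mul_meanRow]
    have hκ : θ.κ ^ 2 ≤ θ.κ := by nlinarith [hθ.κ_nonneg, hθ.κ_le_one]
    exact mul_le_mul hκ hs (Finset.sum_nonneg fun i _ => integral_nonneg fun x => sq_nonneg _)
      hθ.κ_nonneg
  have hmk := mul_meas_ge_le_integral_of_nonneg (μ := π)
    (f := fun x : Latent n => θ.κ ^ 2 * ∑ i, (geomMatrix n θ x *ᵥ communityVec n) i ^ 2)
    (ae_of_all _ fun x => by positivity)
    ((integrable_finsetSum _ fun i _ => hint i).const_mul _) a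
  rw [le_div_iff₀ ha, mul_comm]
  refine le_trans (mul_le_mul_of_nonneg_left ?_ ha.le) (hmk.trans hI)
  exact measureReal_mono fun x (hx : a < _) => le_of_lt hx

/-- Fubini: for fixed positions with controlled row sums the expected degrees are at most `ρ`, and
the bound for the table applies; other positions contribute nothing to the event. -/
theorem law_noiseBound_ge_le (hθ : θ.Admissible) (hγ : 0 ≤ θ.γ) {R ρ D s t : ℝ}
    (hρ : lam1 n θ + θ.κ * R + 1 ≤ ρ) (hD : 0 ≤ D) (hs : 0 < s) (ht : 0 < t) (k : ℕ) :
    law n {ω | (∀ i, ∑ j, geomMatrix n θ ω.1 i j ≤ R)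
        ∧ t ≤ noiseBound (edgeProb n θ ω.1) D s k ω.2}
      ≤ ENNReal.ofReal ((s + s * ((2 * n : ℕ) * (2 * k * D / s ^ 2) ^ k)
        + 2 * ((2 * n : ℕ) : ℝ) ^ 2 * Real.exp (7 * ρ - D / 2)) / t) := by
  set b := (s + s * ((2 * n : ℕ) * (2 * k * D / s ^ 2) ^ k)
        + 2 * ((2 * n : ℕ) : ℝ) ^ 2 * Real.exp (7 * ρ - D / 2)) / t
  have hmeas : MeasurableSet {ω : Sample n | (∀ i, ∑ j, geomMatrix n θ ω.1 i j ≤ R)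
        ∧ t ≤ noiseBound (edgeProb n θ ω.1) D s k ω.2} := by
    refine MeasurableSet.inter ?_ ?_
    · have : {ω : Sample n | ∀ i, ∑ j, geomMatrix n θ ω.1 i j ≤ R}
          = ⋂ i, {ω : Sample n | ∑ j, geomMatrix n θ ω.1 i j ≤ R} := by
        ext ω
        simp
      change MeasurableSet {ω : Sample n | ∀ i, ∑ j, geomMatrix n θ ω.1 i j ≤ R}
      rw [this]
      refine MeasurableSet.iInter fun i => measurableSet_le ?_ measurable_const
      exact Finset.measurable_sum _ fun j _ => (measurable_geomMatrix i j).comp measurable_fst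
    · exact measurableSet_le measurable_const
        (measurable_noiseBound (Ω := Latent n) (p := fun x => edgeProb n θ x)
          (fun i j => measurable_edgeProb i j) D s k)
  rw [law_eq_prod, Measure.prod_apply hmeas]
  refine (lintegral_mono (g := fun _ => ENNReal.ofReal b) fun x => ?_).trans (by simp)
  by_cases hx : ∀ i, ∑ j, geomMatrix n θ x i j ≤ R
  · refine (measure_mono fun U hU => ?_).trans (tableLaw_noiseBound_ge_le
      (edgeProb_symm x) (edgeProb_nonneg hθ x) (edgeProb_le_one hθ hγ x) (ρ := ρ)
      (fun i => ?_) hD hs ht k)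
    · exact hU.2
    · refine (sum_edgeProb_le hθ x i).trans (le_trans ?_ hρ)
      have := mul_le_mul_of_nonneg_left (hx i) hθ.κ_nonneg
      linarith
  · have : Prod.mk x ⁻¹' {ω : Sample n | (∀ i, ∑ j, geomMatrix n θ ω.1 i j ≤ R)
        ∧ t ≤ noiseBound (edgeProb n θ ω.1) D s k ω.2} = ∅ := by
      ext U
      simp only [Set.mem_preimage, Set.mem_ofPred_eq, Set.mem_empty_iff_false, iff_false]
      exact fun h => hx h.1
    rw [this, measure_empty]
    exact bot_le

/-- The bound of the noise for moments of logarithmic order. -/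
theorem law_noiseBound_ge_le_of_log (hθ : θ.Admissible) (hγ : 0 ≤ θ.γ) {R t : ℝ}
    (hR : lam1 n θ + θ.κ * R + 1 ≤ 3 * lam1 n θ) (hL1 : 1 ≤ Real.log (2 * n : ℕ))
    (hL : Real.log (2 * n : ℕ) ≤ lam1 n θ) (ht : 0 < t) :
    law n {ω | (∀ i, ∑ j, geomMatrix n θ ω.1 i j ≤ R)
        ∧ t ≤ noiseBound (edgeProb n θ ω.1) (50 * lam1 n θ)
          √(600 * (lam1 n θ * Real.log (2 * n : ℕ))) ⌈Real.log (2 * n : ℕ)⌉₊ ω.2}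
      ≤ ENNReal.ofReal ((2 * √(600 * (lam1 n θ * Real.log (2 * n : ℕ))) + 2) / t) := by
  set L := Real.log (2 * n : ℕ) with hLdef
  set ℓ := lam1 n θ
  set k := ⌈L⌉₊
  set s := √(600 * (ℓ * L))
  have hL0 : 0 < L := by linarith
  have hℓ0 : 0 < ℓ := by linarith
  have hs : 0 < s := Real.sqrt_pos.mpr (by positivity)
  have hs2 : s ^ 2 = 600 * (ℓ * L) := Real.sq_sqrt (by positivity)
  have hN : (0 : ℝ) < (2 * n : ℕ) := by
    by_contra! h
    have h0 : ((2 * n : ℕ) : ℝ) = 0 := le_antisymm h (Nat.cast_nonneg _)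
    rw [hLdef, h0, Real.log_zero] at hL0
    exact lt_irrefl _ hL0
  have hexpL : Real.exp L = (2 * n : ℕ) := Real.exp_log hN
  have hkL : L ≤ k := Nat.le_ceil L
  have hk2 : (k : ℝ) ≤ 2 * L := by
    have := Nat.ceil_lt_add_one hL0.le
    linarith
  refine (law_noiseBound_ge_le hθ hγ hR (by positivity) hs ht k).trans
    (ENNReal.ofReal_le_ofReal ?_)
  refine div_le_div_of_nonneg_right ?_ ht.le
  -- As `k ≤ 2 L`, the quotient `k / (6 L)` is at most `1/3 < 1/e`; its `k`-th power with `k ≥ log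
  -- N` then absorbs the factor `N`.
  have hratio : 2 * k * (50 * ℓ) / s ^ 2 ≤ Real.exp (-1) := by
    have h1 : 2 * k * (50 * ℓ) / s ^ 2 ≤ 1 / 3 := by
      rw [hs2, div_le_iff₀ (by positivity)]
      nlinarith
    have h2 : 1 / 3 ≤ Real.exp (-1) := by
      rw [Real.exp_neg, ← one_div]
      exact one_div_le_one_div_of_le (Real.exp_pos 1) (by linarith [Real.exp_one_lt_d9])
    exact h1.trans h2
  have hpow : (2 * n : ℕ) * (2 * k * (50 * ℓ) / s ^ 2) ^ k ≤ 1 := by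
    calc ((2 * n : ℕ) : ℝ) * (2 * k * (50 * ℓ) / s ^ 2) ^ k
        ≤ (2 * n : ℕ) * Real.exp (-1) ^ k := by gcongr
      _ = Real.exp (L - k) := by
          rw [← hexpL, ← Real.exp_nat_mul, ← Real.exp_add]
          congr 1
          ring
      _ ≤ 1 := Real.exp_le_one_iff.mpr (by linarith)
  -- The exponent is `2 L + 21 ℓ - 25 ℓ`, negative because `L ≤ ℓ`; this is why the row threshold is
  -- `50 ℓ`.
  have hexp : ((2 * n : ℕ) : ℝ) ^ 2 * Real.exp (7 * (3 * ℓ) - 50 * ℓ / 2) ≤ 1 := by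
    rw [← hexpL, ← Real.exp_nat_mul, ← Real.exp_add]
    refine Real.exp_le_one_iff.mpr ?_
    push_cast
    linarith
  have := mul_le_mul_of_nonneg_left hpow hs.le
  linarith

end Events

/-! ### Asymptotics: the correlation tends to one -/

theorem WithHighProbability.mono {E E' : ∀ n, Set (Sample n)} (h : WithHighProbability E)
    (hE : ∀ᶠ n in atTop, E n ⊆ E' n) : WithHighProbability E' :=
  tendsto_of_tendsto_of_tendsto_of_le_of_le' tendsto_const_nhds h
    (Eventually.of_forall fun _ => bot_le)
    (hE.mono fun _ hn => measure_mono (Set.compl_subset_compl.mpr hn))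

theorem withHighProbability_of_le {E : ∀ n, Set (Sample n)} {f₁ f₂ f₃ : ℕ → ℝ}
    (h₁ : Tendsto f₁ atTop (𝓝 0)) (h₂ : Tendsto f₂ atTop (𝓝 0)) (h₃ : Tendsto f₃ atTop (𝓝 0))
    (h : ∀ᶠ n in atTop, law n (E n)ᶜ
      ≤ ENNReal.ofReal (f₁ n) + ENNReal.ofReal (f₂ n) + ENNReal.ofReal (f₃ n)) :
    WithHighProbability E := by
  refine tendsto_of_tendsto_of_tendsto_of_le_of_le' tendsto_const_nhds ?_
    (Eventually.of_forall fun _ => bot_le) h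
  simpa using ((ENNReal.tendsto_ofReal h₁).add (ENNReal.tendsto_ofReal h₂)).add
    (ENNReal.tendsto_ofReal h₃)

theorem tendsto_two_mul_cast : Tendsto (fun n : ℕ => ((2 * n : ℕ) : ℝ)) atTop atTop :=
  tendsto_natCast_atTop_atTop.comp (tendsto_id.const_mul_atTop' two_pos)

theorem tendsto_log_two_mul :
    Tendsto (fun n : ℕ => Real.log ((2 * n : ℕ) : ℝ)) atTop atTop :=
  Real.tendsto_log_atTop.comp tendsto_two_mul_cast

theorem NotSparse.tendsto_lam1 {θ : ℕ → Params} (h : NotSparse θ) :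
    Tendsto (fun n => lam1 n (θ n)) atTop atTop := by
  refine (Tendsto.atTop_mul_atTop₀ h tendsto_log_two_mul).congr' ?_
  filter_upwards [tendsto_log_two_mul.eventually_gt_atTop 0] with n hn
  rw [div_mul_cancel₀ _ hn.ne']

theorem tendsto_noise_bound {θ : ℕ → Params} (h : NotSparse θ) (b : ℝ) :
    Tendsto (fun n => (2 * √(600 * (lam1 n (θ n) * Real.log (2 * n : ℕ))) + 2)
      / (b * lam1 n (θ n))) atTop (𝓝 0) := by
  have h1 : Tendsto (fun n => 2 / b * √(600 * (lam1 n (θ n) / Real.log (2 * n : ℕ))⁻¹)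
      + 2 / b * (lam1 n (θ n))⁻¹) atTop (𝓝 0) := by
    have hr : Tendsto (fun n => (lam1 n (θ n) / Real.log (2 * n : ℕ))⁻¹) atTop (𝓝 0) :=
      tendsto_inv_atTop_zero.comp h
    have hl : Tendsto (fun n => (lam1 n (θ n))⁻¹) atTop (𝓝 0) :=
      tendsto_inv_atTop_zero.comp h.tendsto_lam1
    have hs := (Real.continuous_sqrt.tendsto _).comp (hr.const_mul 600)
    simpa using (hs.const_mul (2 / b)).add (hl.const_mul (2 / b))
  refine h1.congr' ?_
  filter_upwards [h.tendsto_lam1.eventually_gt_atTop 0,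
    tendsto_log_two_mul.eventually_gt_atTop 0] with n hn hL
  have e : √(600 * (lam1 n (θ n) / Real.log (2 * n : ℕ))⁻¹)
      = √(600 * (lam1 n (θ n) * Real.log (2 * n : ℕ))) / lam1 n (θ n) := by
    rw [eq_div_iff hn.ne']
    nth_rw 2 [← Real.sqrt_sq hn.le]
    rw [← Real.sqrt_mul (by positivity)]
    congr 1
    field_simp
  rw [e]
  by_cases hb : b = 0
  · simp [hb]
  · field_simp

/-- With high probability, the correlation of the second eigenvector with the community vector is
arbitrarily close to one. -/
theorem withHighProbability_sq_correlation {c C : ℝ} (hc : 0 < c) (hC : C < 1) {θ : ℕ → Params}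
    (hθ : ∀ n, (θ n).Admissible) (hreg : LatentRegime θ) (hsig : SignalDominates c C θ)
    (hsp : NotSparse θ) {ε : ℝ} (hε : 0 < ε) :
    WithHighProbability fun n => {ω | ∀ w, IsSecondEigenvector (adjMatrix n (θ n) ω) w →
      1 - ε ≤ (w ⬝ᵥ communityVec n) ^ 2} := by
  obtain ⟨hnoise, hratio, -⟩ := hsig
  have hC0 : 0 ≤ C := by
    obtain ⟨n, hn⟩ := hratio.exists
    linarith [hn.1, hn.2]
  obtain ⟨τ, hτ, hτC, hτε⟩ : ∃ τ : ℝ, 0 < τ ∧ 6 * τ < 1 - C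
      ∧ (3 * τ / (1 - C - 3 * τ)) ^ 2 ≤ ε := by
    set e := min ε 1
    have he0 : 0 < e := lt_min hε one_pos
    have he1 : e ≤ 1 := min_le_right _ _
    have hd : 0 < 1 - C := by linarith
    have hde : (1 - C) * e ≤ 1 - C := mul_le_of_le_one_right hd.le he1
    -- Then `3 τ = (1 - C) e / 4` and the gap is at least `3 (1 - C) / 4`, so the ratio is at most
    -- `e / 3`.
    refine ⟨(1 - C) * e / 12, by positivity, by linarith, ?_⟩
    have hr : 3 * ((1 - C) * e / 12) / (1 - C - 3 * ((1 - C) * e / 12)) ≤ e := by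
      rw [div_le_iff₀ (by linarith)]
      nlinarith [mul_pos hd he0]
    have hr0 : 0 ≤ 3 * ((1 - C) * e / 12) / (1 - C - 3 * ((1 - C) * e / 12)) :=
      div_nonneg (by positivity) (by linarith)
    calc _ ≤ e ^ 2 := pow_le_pow_left₀ hr0 hr 2
      _ ≤ e := by nlinarith
      _ ≤ ε := min_le_left _ _
  have hlam1 := hsp.tendsto_lam1
  have hlam2 : Tendsto (fun n => lam2 n (θ n)) atTop atTop := by
    refine tendsto_atTop_mono' _ ?_ (hlam1.const_mul_atTop hc)
    filter_upwards [hratio, hlam1.eventually_gt_atTop 0] with n h1 h2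
    exact (le_div_iff₀ h2).mp h1.1
  have hf1 : Tendsto (fun n : ℕ => (((2 * n : ℕ) : ℝ))⁻¹) atTop (𝓝 0) :=
    tendsto_inv_atTop_zero.comp tendsto_two_mul_cast
  have hf2 : Tendsto (fun n => C / τ ^ 2 * (lam2 n (θ n))⁻¹) atTop (𝓝 0) := by
    simpa using (tendsto_inv_atTop_zero.comp hlam2).const_mul (C / τ ^ 2)
  refine withHighProbability_of_le hf1 hf2 (tendsto_noise_bound hsp (τ * c)) ?_
  filter_upwards [hnoise, hratio, hlam1.eventually_ge_atTop 1, hlam2.eventually_gt_atTop 0,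
    hlam2.eventually_ge_atTop (1 / τ), hreg.1.eventually_gt_atTop 0,
    hreg.2.eventually_ge_atTop (16 / τ ^ 2), tendsto_log_two_mul.eventually_ge_atTop 1,
    hsp.eventually_ge_atTop 1, eventually_gt_atTop 0]
    with n h1 h2 hl1 hl2 hτl hγ hlat hL1 hL hn
  have hl1' : 0 < lam1 n (θ n) := by linarith
  have hL0 : 0 < Real.log (2 * n : ℕ) := by linarith
  have hNpos : (0 : ℝ) < (2 * n : ℕ) := by exact_mod_cast (by omega : 0 < 2 * n)
  have hlam2C : lam2 n (θ n) ≤ C * lam1 n (θ n) := (div_le_iff₀ hl1').mp h2.2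
  have hlam2c : c * lam1 n (θ n) ≤ lam2 n (θ n) := (le_div_iff₀ hl1').mp h2.1
  have hLlam : Real.log (2 * n : ℕ) ≤ lam1 n (θ n) := (one_le_div hL0).mp hL
  have hnoiseC : noise n (θ n) ≤ C * lam2 n (θ n) := by
    rwa [inv_mul_eq_div, div_le_iff₀ hl2] at h1
  have hdiag : 1 ≤ τ * lam2 n (θ n) := by
    rwa [div_le_iff₀ hτ, mul_comm] at hτl
  set R := (1 + τ) * meanRow n (θ n) with hR
  have hκR : (θ n).κ * R ≤ (C + τ) * lam2 n (θ n) := by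
    have e : (θ n).κ * R = (1 + τ) * noise n (θ n) := by
      rw [hR, ← kappa_mul_meanRow]
      ring
    rw [e]
    calc (1 + τ) * noise n (θ n) ≤ (1 + τ) * (C * lam2 n (θ n)) := by gcongr
      _ ≤ (C + τ) * lam2 n (θ n) := by
        have : τ * C ≤ τ := mul_le_of_le_one_right hτ.le hC.le
        nlinarith
  have hlam21 : lam2 n (θ n) ≤ lam1 n (θ n) := by nlinarith
  have hR3 : lam1 n (θ n) + (θ n).κ * R + 1 ≤ 3 * lam1 n (θ n) := by
    have : (C + τ) * lam2 n (θ n) ≤ lam2 n (θ n) := mul_le_of_le_one_left hl2.le (by linarith)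
    linarith
  set t := τ * lam2 n (θ n) with ht
  have ht0 : 0 < t := by positivity
  set s := √(600 * (lam1 n (θ n) * Real.log (2 * n : ℕ))) with hsdef
  set k := ⌈Real.log (2 * n : ℕ)⌉₊ with hk
  set S₁ : Set (Sample n) := {ω | ∃ i, R ≤ ∑ j, geomMatrix n (θ n) ω.1 i j} with hS1
  set S₂ : Set (Sample n) :=
    {ω | t ^ 2 < (θ n).κ ^ 2 * ∑ i, (geomMatrix n (θ n) ω.1 *ᵥ communityVec n) i ^ 2} with hS2
  set S₃ : Set (Sample n) := {ω | (∀ i, ∑ j, geomMatrix n (θ n) ω.1 i j ≤ R)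
    ∧ t ≤ noiseBound (edgeProb n (θ n) ω.1) (50 * lam1 n (θ n)) s k ω.2} with hS3
  -- The failure event is covered by a large kernel row, a large cross term, and large noise while
  -- all rows are controlled.
  have hsub : {ω | ∀ w, IsSecondEigenvector (adjMatrix n (θ n) ω) w →
      1 - ε ≤ (w ⬝ᵥ communityVec n) ^ 2}ᶜ ⊆ S₁ ∪ S₂ ∪ S₃ := by
    rw [Set.compl_subset_comm]
    intro ω hω w hw
    simp only [Set.mem_compl_iff, Set.mem_union, not_or] at hω
    obtain ⟨⟨hω1, hω2⟩, hω3⟩ := hω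
    have hrow : ∀ i, ∑ j, geomMatrix n (θ n) ω.1 i j ≤ R := fun i => by
      by_contra! h
      exact hω1 ⟨i, h.le⟩
    have hnb : noiseBound (edgeProb n (θ n) ω.1) (50 * lam1 n (θ n)) s k ω.2 ≤ t := by
      by_contra! h
      exact hω3 ⟨hrow, h.le⟩
    refine le_trans (by linarith) (sq_correlation_ge_of_bounds (hθ n) hn hτ hτC hC0 hl2 hlam2C
      hdiag (fun i => ?_) (not_lt.mp hω2) (fun u hu => ?_) hw)
    · exact (mul_le_mul_of_nonneg_left (hrow i) (hθ n).κ_nonneg).trans hκR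
    · rw [adjMatrix_eq_patternMatrix]
      exact (abs_dotProduct_noise_le_noiseBound (edgeProb_symm ω.1) (edgeProb_nonneg (hθ n) ω.1)
        (edgeProb_le_one (hθ n) hγ.le ω.1) (Real.sqrt_pos.mpr (by positivity))
        (Nat.ceil_pos.mpr hL0) hu ω.2).trans hnb
  refine (measure_mono hsub).trans ((measure_union_le _ _).trans
    (add_le_add ((measure_union_le _ _).trans (add_le_add ?_ ?_)) ?_))
  · refine (law_row_sum_ge_le hγ hτ (by linarith)).trans (ENNReal.ofReal_le_ofReal ?_)
    -- This is where `γ ≪ N / log N` enters, with the threshold `16 / τ²`: each row fails with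
    -- probability at most `N⁻²`, and the union bound leaves `1 / N`.
    have hM : 2 * Real.log (2 * n : ℕ) ≤ τ ^ 2 / 4 * meanRow n (θ n) := by
      have e : τ ^ 2 / 4 * meanRow n (θ n) = τ ^ 2 / 8 * Real.log (2 * n : ℕ)
          * (1 / (θ n).γ * ((2 * n : ℕ) / Real.log (2 * n : ℕ))) := by
        rw [meanRow]
        field_simp
        ring
      rw [e]
      have := mul_le_mul_of_nonneg_left hlat
        (by positivity : 0 ≤ τ ^ 2 / 8 * Real.log (2 * n : ℕ))
      refine le_trans (le_of_eq ?_) this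
      field_simp
      ring
    calc ((2 * n : ℕ) : ℝ) * Real.exp (-(τ ^ 2 / 4 * meanRow n (θ n)))
        ≤ (2 * n : ℕ) * Real.exp (-(2 * Real.log (2 * n : ℕ))) := by gcongr
      _ = (((2 * n : ℕ) : ℝ))⁻¹ := by
        rw [Real.exp_neg, two_mul (Real.log _), Real.exp_add, Real.exp_log hNpos]
        field_simp
  · refine (law_cross_gt_le (hθ n) hn hγ (by positivity)).trans (ENNReal.ofReal_le_ofReal ?_)
    rw [div_le_iff₀ (by positivity)]
    -- Noise at most `C λ₂` against `t² = τ² λ₂²` leaves `C / (τ² λ₂)`, which tends to zero.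
    refine hnoiseC.trans (le_of_eq ?_)
    rw [ht]
    field_simp
  · refine (law_noiseBound_ge_le_of_log (hθ n) hγ.le hR3 hL1 hLlam ht0).trans
      (ENNReal.ofReal_le_ofReal ?_)
    refine div_le_div_of_nonneg_left (by positivity) (by positivity) ?_
    rw [ht, mul_assoc]
    gcongr

theorem withHighProbability_correlation {c C : ℝ} (hc : 0 < c) (hC : C < 1) {θ : ℕ → Params}
    (hθ : ∀ n, (θ n).Admissible) (hreg : LatentRegime θ) (hsig : SignalDominates c C θ)
    (hsp : NotSparse θ) {ε : ℝ} (hε : 0 < ε) : SoftRecovery θ (1 - ε) := by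
  refine (withHighProbability_sq_correlation hc hC hθ hreg hsig hsp hε).mono
    (Eventually.of_forall fun n ω hω w hw => ?_)
  have h := hω w hw
  rw [← sq_abs] at h
  by_contra! hlt
  nlinarith [abs_nonneg (w ⬝ᵥ communityVec n)]

end PerturbedSBM

/-! ### The theorem -/

open PerturbedSBM in
theorem theorem2 (c C : ℝ) (hc : 0 < c) (hC : C < 1) :
    ∃ δ : ℝ, 0 < δ ∧ ∃ K : ℝ, ∀ θ : ℕ → Params,
      (∀ n, (θ n).Admissible) → LatentRegime θ → SignalDominates c C θ → NotSparse θ →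
      (∀ᶠ n in atTop, lam2 n (θ n) + 2 * ((θ n).κ / (2 * (θ n).γ)) < lam1 n (θ n)) →
      -- soft recovery, when signal and noise are of the same order
      (NoiseComparable c θ → SoftRecovery θ δ) ∧
      -- correlation tending to one and asymptotically exact weak recovery
      (RatioToInfinity θ → ∀ ε : ℝ, 0 < ε → SoftRecovery θ (1 - ε) ∧ WeakRecovery θ (1 - ε)) ∧
      -- explicit asymptotic lower bounds on the correlation
      (∀ ε : ℝ, 0 < ε →
        (WithHighProbability fun n => {ω | ∀ w, IsSecondEigenvector (adjMatrix n (θ n) ω) w →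
          ∀ g : ℝ,
            IsBoundParameter (lam1 n (θ n) / lam2 n (θ n)) (mu1 n (θ n) ω / lam2 n (θ n)) g →
            (g + 1) * (mu1 n (θ n) ω / lam2 n (θ n)) ≤ 1 / 2 →
            sqCorrelationBound (lam1 n (θ n) / lam2 n (θ n)) (mu1 n (θ n) ω / lam2 n (θ n)) g - ε
              ≤ (w ⬝ᵥ communityVec n) ^ 2}) ∧
        (WithHighProbability fun n => {ω | ∀ w, IsSecondEigenvector (adjMatrix n (θ n) ω) w →
          correlationExpansion (lam1 n (θ n) / lam2 n (θ n)) (mu1 n (θ n) ω / lam2 n (θ n))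
              - K * (mu1 n (θ n) ω / lam2 n (θ n)) - ε
            ≤ |w ⬝ᵥ communityVec n|})) := by
  -- Since the correlation tends to one, any `δ < 1` would serve, and no linear correction is
  -- needed: `K = 0`.
  refine ⟨1 / 2, by norm_num, 0, fun θ hθ hreg hsig hsp _ => ?_⟩
  have hsoft : ∀ ε : ℝ, 0 < ε → SoftRecovery θ (1 - ε) := fun ε hε =>
    withHighProbability_correlation hc hC hθ hreg hsig hsp hε
  have hratio : ∀ᶠ n in atTop, 0 < n ∧ 0 < lam2 n (θ n) ∧ 1 < lam1 n (θ n) / lam2 n (θ n) := by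
    filter_upwards [hsig.2.1, eventually_gt_atTop 0] with n h hn
    have h1 := lam1_pos (hθ n) hn
    have h2 : 0 < lam2 n (θ n) := by
      have := (le_div_iff₀ h1).mp h.1
      have := mul_pos hc h1
      linarith
    refine ⟨hn, h2, (one_lt_div h2).mpr ?_⟩
    have := (div_le_iff₀ h1).mp h.2
    nlinarith
  refine ⟨fun _ => ?_, fun _ ε hε => ⟨hsoft ε hε, ?_⟩, fun ε hε => ⟨?_, ?_⟩⟩
  · have := hsoft (1 / 2) (by norm_num)
    norm_num at this ⊢
    exact this
  -- Rounding multiplies the deficit by four: `4 (1 - ε / 4) - 3 = 1 - ε`.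
  · refine (hsoft (ε / 4) (by positivity)).mono ?_
    filter_upwards [eventually_gt_atTop 0] with n hn ω hω w hw
    have h1 := abs_signVec_dotProduct_communityVec_ge hn hw.1
    have h2 := hω w hw
    linarith
  · refine (withHighProbability_sq_correlation hc hC hθ hreg hsig hsp hε).mono ?_
    filter_upwards [hratio] with n ⟨hn, hl, hq⟩ ω hω w hw g hg hgx
    have h1 := sqCorrelationBound_le_one hq (div_nonneg (mu1_nonneg (hθ n) hn ω) hl.le) hg hgx
    have h2 := hω w hw
    linarith
  · refine (hsoft ε hε).mono ?_
    filter_upwards [hratio] with n ⟨hn, hl, hq⟩ ω hω w hw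
    have h1 := correlationExpansion_le_one (by linarith : 0 ≤ lam1 n (θ n) / lam2 n (θ n))
      (mu1 n (θ n) ω / lam2 n (θ n))
    have h2 := hω w hw
    linarith
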